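/- **Theorem (Multi-Step Policy Gradient).** Consider a discounted Markov decision process with a measurable observation (state) space $\mathcal O$, action space $\mathbb R^{d}$, initial law $\rho_0$, transition kernel $P(\cdot\mid o,a)$, measurable reward $r(o,a)$ and discount factor $\gamma\in[0,1)$. Let $K\ge 1$, $\sigma>0$, $\tau_k=1-k/K$, $\Delta\tau_k=\tau_k-\tau_{k+1}=1/K$, and let $u_\vartheta(a,r,\tau,o)\in\mathbb R^d$, $\vartheta\in\mathbb R^p$, be a parametrized velocity field, measurable in $(a,r,\tau,o)$ for each $\vartheta$. Given $o$, the MeanFlow policy generates the denoising chain $a^{0:K}=(a^0,\dots,a^K)$, $$a^0\sim\mathcal N(0,I),\qquad a^{k+1}\sim\pi_\vartheta(\cdot\mid a^k,o)=\mathcal N\big(a^k-\Delta\tau_k\,u_\vartheta(a^k,\tau_{k+1},\tau_k,o),\ \sigma^2I\big),\quad 0\le k<K,$$ and executes $a=a^K$; the law of $a^K$ given $o$ is $\pi_\vartheta(\cdot\mid o)$. Let $\ln\pi_\vartheta(a^{k+1}\mid a^k,o)$ be the log-density of the $k$-th transition. For rollouts $(o_t,a_t)_{t\ge0}$ of $\pi_\vartheta$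 put $J(\pi_\vartheta)=\mathbb E[\sum_{t\ge0}\gamma^t r(o_t,a_t)]$ with $o_0\sim\rho_0$, $V^{\pi_\vartheta}(o)=\mathbb E[\sum_t\gamma^t r(o_t,a_t)\mid o_0=o]$, $Q^{\pi_\vartheta}(o,a)=\mathbb E[\sum_t\gamma^t r(o_t,a_t)\mid o_0=o,a_0=a]$, $A^{\pi_\vartheta}=Q^{\pi_\vartheta}-V^{\pi_\vartheta}$, and let $d_\vartheta=\sum_{t\ge0}\gamma^t\,\mathbb P_{\pi_\vartheta}(o_t\in\cdot)$ be the discounted visitation measure, of total mass $1/(1-\gamma)$. Fix $\theta\in\mathbb R^p$ and suppose that there are $C$, $m$ and $\varepsilon>0$ such that $|r(o,a)|\le C(1+\|a\|)^m$ for all $o,a$, and such that for all $\theta'$ with $\|\theta'-\theta\|<\varepsilon$, all $k<K$ and all $a,o$ the map $\vartheta\mapsto u_\vartheta(a,\tau_{k+1},\tau_k,o)$ is differentiable at $\theta'$, and both its value and its derivative at $\theta'$ have norm at most $C(1+\|a\|)^m$. Then, for all $\theta'$ in a neighbourhood of $\theta$, the returns defining $J(\pi_{\theta'})$, $V^{\pi_{\theta'}}(o)$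 and $Q^{\pi_{\theta'}}(o,a)$ (for all $o,a$) converge absolutely in expectation; moreover $\vartheta\mapsto J(\pi_\vartheta)$ is differentiable at $\theta$, and $$\nabla_\theta J(\pi_\theta)=\mathbb E_{o,\,a^{0:K}\sim\pi_\theta}\Big[A^{\pi_\theta}(o,a^K)\,\nabla_\theta\sum_{k=0}^{K-1}\ln\pi_\theta(a^{k+1}\mid a^k,o)\Big],$$ where $\mathbb E_{o,\,a^{0:K}\sim\pi_\theta}$ denotes integration with $o$ distributed according to the (unnormalized) discounted visitation measure $d_\theta$ and $a^{0:K}$ the denoising chain given $o$, and the integrand is integrable. (Equivalently, the right-hand side is $1/(1-\gamma)$ times the expectation with $o$ drawn from the probability measure $(1-\gamma)d_\theta$.) -/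

import Mathlib

open MeasureTheory ProbabilityTheory
open scoped MatrixOrder

noncomputable section

/-! ## The `K`-step MeanFlow policy -/

/-- The action space `ℝ^d` with its Euclidean norm. -/
abbrev Act (d : ℕ) : Type := EuclideanSpace ℝ (Fin d)

/-- An average velocity field `u(a, r, τ, o)`: `a` is the current denoising state, `[r, τ]` is the
flow-time interval (start first, end second), and `o` is the observation. -/
structure VelocityField (d : ℕ) (O : Type*) [MeasurableSpace O] where
  toFun : Act d → ℝ → ℝ → O → Act d
  measurable_toFun : Measurable fun x : Act d × ℝ × ℝ × O => toFun x.1 x.2.1 x.2.2.1 x.2.2.2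

/-- Flow time `τ_k = 1 - k / K`. -/
def flowTime (K k : ℕ) : ℝ := 1 - (k : ℝ) / (K : ℝ)

namespace VelocityField

variable {d : ℕ} {O : Type*} [MeasurableSpace O]

/-- The mean `μ_k = a - (τ_k - τ_{k+1}) u(a, τ_{k+1}, τ_k, o)` of the `k`-th transition. -/
def mean (u : VelocityField d O) (K k : ℕ) (o : O) (a : Act d) : Act d :=
  a - (flowTime K k - flowTime K (k + 1)) • u.toFun a (flowTime K (k + 1)) (flowTime K k) o

theorem measurable_mean (u : VelocityField d O) (K k : ℕ) :
    Measurable fun x : O × Act d => u.mean K k x.1 x.2 := by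
  have h : Measurable fun x : O × Act d =>
      u.toFun x.2 (flowTime K (k + 1)) (flowTime K k) x.1 :=
    u.measurable_toFun.comp
      (measurable_snd.prodMk (measurable_const.prodMk (measurable_const.prodMk measurable_fst)))
  exact measurable_snd.sub (h.const_smul (flowTime K k - flowTime K (k + 1)))

/-- The transition kernel: given `(o, a^k)`, the state `a^{k+1}` has law `N(μ_k, σ² I)`. -/
def transition (u : VelocityField d O) (σ : ℝ) (K k : ℕ) : Kernel (O × Act d) (Act d) where
  toFun x := multivariateGaussian (u.mean K k x.1 x.2) (σ ^ 2 • (1 : Matrix (Fin d) (Fin d) ℝ))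
  measurable' := by
    refine Measure.measurable_of_measurable_coe _ fun s hs => ?_
    have hf : Measurable fun p : (O × Act d) × Act d => u.mean K k p.1.1 p.1.2 +
        Matrix.toEuclideanCLM (𝕜 := ℝ)
          (CFC.sqrt (σ ^ 2 • (1 : Matrix (Fin d) (Fin d) ℝ))) p.2 :=
      ((u.measurable_mean K k).comp measurable_fst).add
        ((ContinuousLinearMap.measurable _).comp measurable_snd)
    have h := measurable_measure_prodMk_left (ν := stdGaussian (Act d)) (hf hs)
    convert h using 2 with x
    rw [multivariateGaussian, Measure.map_apply (by fun_prop) hs]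
    rfl

instance (u : VelocityField d O) (σ : ℝ) (K k : ℕ) : IsMarkovKernel (u.transition σ K k) :=
  ⟨fun x => inferInstanceAs (IsProbabilityMeasure
    (multivariateGaussian (u.mean K k x.1 x.2) (σ ^ 2 • (1 : Matrix (Fin d) (Fin d) ℝ))))⟩

/-- The density `π(a' | a, o)` of the `k`-th transition: the density of `N(μ_k, σ² I)` at `a'`. -/
def transitionDensity (u : VelocityField d O) (σ : ℝ) (K k : ℕ) (o : O) (a a' : Act d) : ℝ :=
  (2 * Real.pi * σ ^ 2) ^ (-(d : ℝ) / 2) *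
    Real.exp (-‖a' - u.mean K k o a‖ ^ 2 / (2 * σ ^ 2))

/-- The law of the first `n + 1` states `(a^0, …, a^n)` of the denoising chain given `o`, where
`a^0 ∼ N(0, I)` and each next state is drawn from the transition kernel. -/
def chain (u : VelocityField d O) (σ : ℝ) (K : ℕ) : (n : ℕ) → Kernel O (Fin (n + 1) → Act d)
  | 0 => Kernel.const O ((stdGaussian (Act d)).map fun a _ => a)
  | n + 1 =>
    (u.chain σ K n ⊗ₖ (u.transition σ K n).comap
      (fun x : O × (Fin (n + 1) → Act d) => (x.1, x.2 (Fin.last n))) (by fun_prop)).map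
      fun p => Fin.snoc (α := fun _ => Act d) p.1 p.2

theorem measurable_snoc (n : ℕ) : Measurable fun p : (Fin n → Act d) × Act d =>
    (Fin.snoc (α := fun _ => Act d) p.1 p.2 : Fin (n + 1) → Act d) := by
  refine measurable_pi_lambda _ fun i => ?_
  refine Fin.lastCases ?_ (fun j => ?_) i
  · simpa using measurable_snd
  · simpa [Function.comp_def] using (measurable_pi_apply j).comp measurable_fst

instance (u : VelocityField d O) (σ : ℝ) (K n : ℕ) : IsMarkovKernel (u.chain σ K n) := by
  induction n with
  | zero =>
    have : IsProbabilityMeasure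
        ((stdGaussian (Act d)).map fun (a : Act d) (_ : Fin (0 + 1)) => a) :=
      Measure.isProbabilityMeasure_map (by fun_prop)
    unfold chain
    infer_instance
  | succ n ih =>
    unfold chain
    exact Kernel.IsMarkovKernel.map _ (measurable_snoc (n + 1))

/-- The policy `π(a | o)`: the law of the final state `a = a^K` of the `K`-step chain. -/
def policy (u : VelocityField d O) (σ : ℝ) (K : ℕ) : Kernel O (Act d) :=
  (u.chain σ K K).map fun a => a (Fin.last K)

instance (u : VelocityField d O) (σ : ℝ) (K : ℕ) : IsMarkovKernel (u.policy σ K) :=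
  Kernel.IsMarkovKernel.map _ (measurable_pi_apply _)

end VelocityField

/-! ## The environment -/

/-- A discounted Markov decision process with observation (state) space `O` and action space
`A`. -/
structure MDP (O A : Type*) [MeasurableSpace O] [MeasurableSpace A] where
  /-- law of the initial observation -/
  init : Measure O
  init_prob : IsProbabilityMeasure init
  /-- law of the next observation -/
  next : Kernel (O × A) O
  next_markov : IsMarkovKernel next
  reward : O → A → ℝ
  measurable_reward : Measurable fun x : O × A => reward x.1 x.2
  /-- discount factor -/
  γ : ℝ
  γ_nonneg : 0 ≤ γ
  γ_lt_one : γ < 1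

namespace MDP

variable {O A : Type*} [MeasurableSpace O] [MeasurableSpace A]

instance (M : MDP O A) : IsProbabilityMeasure M.init := M.init_prob

instance (M : MDP O A) : IsMarkovKernel M.next := M.next_markov

/-- One step `(o_t, a_t) ↦ (o_{t+1}, a_{t+1})` under the policy `π`. -/
def step (M : MDP O A) (π : Kernel O A) : Kernel (O × A) (O × A) :=
  M.next ⊗ₖ π.prodMkLeft (O × A)

instance (M : MDP O A) (π : Kernel O A) [IsMarkovKernel π] : IsMarkovKernel (M.step π) := by
  unfold step
  infer_instance

/-- The law of the rollout `(o_t, a_t)_{t ≥ 0}` under `π`, given `(o_0, a_0)`. -/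
def rolloutFromPair (M : MDP O A) (π : Kernel O A) [IsMarkovKernel π] :
    Kernel (O × A) (ℕ → O × A) :=
  (Kernel.traj (X := fun _ => O × A) (fun n => (M.step π).comap
    (fun h : (Finset.Iic n) → O × A => h ⟨n, Finset.mem_Iic.2 le_rfl⟩) (by fun_prop)) 0).comap
    (fun x _ => x) (by fun_prop)

instance (M : MDP O A) (π : Kernel O A) [IsMarkovKernel π] :
    IsMarkovKernel (M.rolloutFromPair π) := by
  unfold rolloutFromPair
  infer_instance

/-- The law of the rollout under `π`, given `o_0`. -/
def rolloutFromObs (M : MDP O A) (π : Kernel O A) [IsMarkovKernel π] : Kernel O (ℕ → O × A) :=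
  M.rolloutFromPair π ∘ₖ (Kernel.id ×ₖ π)

instance (M : MDP O A) (π : Kernel O A) [IsMarkovKernel π] :
    IsMarkovKernel (M.rolloutFromObs π) := by
  unfold rolloutFromObs
  infer_instance

/-- The law of the rollout under `π`, with `o_0` drawn from the initial law. -/
def rollout (M : MDP O A) (π : Kernel O A) [IsMarkovKernel π] : Measure (ℕ → O × A) :=
  M.rolloutFromObs π ∘ₘ M.init

instance (M : MDP O A) (π : Kernel O A) [IsMarkovKernel π] :
    IsProbabilityMeasure (M.rollout π) := by
  unfold rollout
  infer_instance

/-- The discounted return `∑_t γ^t r(o_t, a_t)` of a rollout. -/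
def discountedReturn (M : MDP O A) (ω : ℕ → O × A) : ℝ :=
  ∑' t, M.γ ^ t * M.reward (ω t).1 (ω t).2

/-- The sum `∑_t |γ^t r(o_t, a_t)|`, with values in `[0, ∞]`. -/
def absReturn (M : MDP O A) (ω : ℕ → O × A) : ENNReal :=
  ∑' t, ‖M.γ ^ t * M.reward (ω t).1 (ω t).2‖ₑ

/-- `J(π)`, the expected discounted return. -/
def J (M : MDP O A) (π : Kernel O A) [IsMarkovKernel π] : ℝ :=
  ∫ ω, M.discountedReturn ω ∂(M.rollout π)

/-- The value function `V^π(o)`. -/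
def value (M : MDP O A) (π : Kernel O A) [IsMarkovKernel π] (o : O) : ℝ :=
  ∫ ω, M.discountedReturn ω ∂(M.rolloutFromObs π o)

/-- The state-action value function `Q^π(o, a)`. -/
def qValue (M : MDP O A) (π : Kernel O A) [IsMarkovKernel π] (o : O) (a : A) : ℝ :=
  ∫ ω, M.discountedReturn ω ∂(M.rolloutFromPair π (o, a))

/-- The advantage function `A^π(o, a) = Q^π(o, a) - V^π(o)`. -/
def advantage (M : MDP O A) (π : Kernel O A) [IsMarkovKernel π] (o : O) (a : A) : ℝ :=
  M.qValue π o a - M.value π o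

/-- The discounted visitation measure `∑_t γ^t P(o_t ∈ ·)` of the observations in rollouts of
`π`; its total mass is `1 / (1 - γ)`. -/
def visitation (M : MDP O A) (π : Kernel O A) [IsMarkovKernel π] : Measure O :=
  Measure.sum fun t => ENNReal.ofReal (M.γ ^ t) • (M.rollout π).map fun ω => (ω t).1

instance (M : MDP O A) (π : Kernel O A) [IsMarkovKernel π] :
    IsFiniteMeasure (M.visitation π) := by
  refine ⟨?_⟩
  have h : ∀ t, ((M.rollout π).map fun ω => (ω t).1) Set.univ = 1 := fun t => by
    rw [Measure.map_apply (by fun_prop) MeasurableSet.univ]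
    simp
  simp only [visitation, Measure.sum_apply _ MeasurableSet.univ, Measure.smul_apply, h,
    smul_eq_mul, mul_one]
  exact (summable_geometric_of_lt_one M.γ_nonneg M.γ_lt_one).tsum_ofReal_lt_top

end MDP

end

/-! Let `A_θ` be the advantage function at the parameter `θ`. By the performance difference lemma,
`J(π_ϑ) - J(π_θ)` is the integral of `A_θ` against `d_ϑ ⊗ π_ϑ`. Since `A_θ` has mean zero under
`π_θ`, its conditional mean under `π_ϑ` is `O(‖ϑ - θ‖)`, and `d_ϑ` and `d_θ` differ by
`O(‖ϑ - θ‖)` in total variation. Replacing `d_ϑ` by `d_θ` therefore costs only `O(‖ϑ - θ‖²)`, so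
the derivative of `J` at `θ` is that of `ϑ ↦ ∫ A_θ ∂(d_θ ⊗ π_ϑ)`. As `π_ϑ` is the last marginal of
the denoising chain, whose density is the product of the Gaussian transition densities,
differentiation under the integral sign turns this into the score function formula. Polynomial
growth of the velocity field keeps the chain densities and their derivatives, also after
multiplication with polynomial weights, below an integrable function that depends neither on the
observation nor on the parameter. -/

open scoped ENNReal NNReal RealInnerProductSpace

/-! ### Discounted occupancy measures -/

theorem integral_comp_measure {α β F : Type*} [MeasurableSpace α] [MeasurableSpace β]
    [NormedAddCommGroup F] [NormedSpace ℝ F] {κ : Kernel α β} {μ : Measure α} {f : β → F}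
    (hf : Integrable f (κ ∘ₘ μ)) : ∫ y, f y ∂(κ ∘ₘ μ) = ∫ x, ∫ y, f y ∂κ x ∂μ := by
  rw [Measure.comp_eq_comp_const_apply] at hf ⊢
  rw [Kernel.integral_comp hf, Kernel.const_apply]

namespace MDP

section Occupancy

variable {O A : Type*} [MeasurableSpace O] [MeasurableSpace A]
variable (M : MDP O A) (π : Kernel O A) [IsMarkovKernel π]

/-- The kernel `M.step π` applied to the last entry of a history of length `n + 1`, in the form
in which the Ionescu-Tulcea construction of the rollout takes it. -/
noncomputable def historyStep (n : ℕ) : Kernel (Finset.Iic n → O × A) (O × A) :=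
  (M.step π).comap (fun h => h ⟨n, Finset.mem_Iic.2 le_rfl⟩) (measurable_pi_apply _)

instance (n : ℕ) : IsMarkovKernel (M.historyStep π n) := by
  unfold historyStep
  infer_instance

/-- The law of `(o_t, a_t)` given `(o_0, a_0)`. -/
noncomputable def timeLaw (t : ℕ) : Kernel (O × A) (O × A) :=
  (M.rolloutFromPair π).map fun ω => ω t

instance (t : ℕ) : IsMarkovKernel (M.timeLaw π t) :=
  Kernel.IsMarkovKernel.map _ (measurable_pi_apply t)

theorem timeLaw_eq_comap_traj (t : ℕ) :
    M.timeLaw π t =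
      ((Kernel.traj (X := fun _ => O × A) (M.historyStep π) 0).map fun ω => ω t).comap
        (fun x _ => x) (by fun_prop) :=
  (Kernel.comap_map_comm _ _ (measurable_pi_apply t)).symm

theorem map_eval_zero_traj_historyStep :
    (Kernel.traj (X := fun _ => O × A) (M.historyStep π) 0).map (fun ω => ω 0) =
      Kernel.id.map fun h => h ⟨0, Finset.mem_Iic.2 le_rfl⟩ := by
  rw [← Kernel.partialTraj_self (X := fun _ => O × A) (κ := M.historyStep π) 0,
    ← Kernel.traj_map_frestrictLe (X := fun _ => O × A) (κ := M.historyStep π) 0 0,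
    ← Kernel.map_comp_right _ (by fun_prop) (by fun_prop)]
  rfl

theorem map_eval_succ_traj_historyStep (t : ℕ) :
    (Kernel.traj (X := fun _ => O × A) (M.historyStep π) 0).map (fun ω => ω (t + 1)) =
      M.step π ∘ₖ (Kernel.traj (X := fun _ => O × A) (M.historyStep π) 0).map fun ω => ω t := by
  rw [← Kernel.traj_comp_partialTraj (X := fun _ => O × A) (κ := M.historyStep π) (Nat.zero_le t),
    Kernel.map_comp, Kernel.map_traj_succ_self, Kernel.traj_comp_partialTraj (Nat.zero_le t),
    ← Kernel.traj_map_frestrictLe, historyStep, ← Kernel.comp_map,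
    ← Kernel.map_comp_right _ (by fun_prop) (by fun_prop)]
  rfl

theorem timeLaw_zero : M.timeLaw π 0 = Kernel.id := by
  rw [timeLaw_eq_comap_traj, map_eval_zero_traj_historyStep,
    Kernel.id_map (measurable_pi_apply _)]
  rfl

theorem timeLaw_succ (t : ℕ) : M.timeLaw π (t + 1) = M.step π ∘ₖ M.timeLaw π t := by
  rw [timeLaw_eq_comap_traj, timeLaw_eq_comap_traj, map_eval_succ_traj_historyStep]
  simp only [← Kernel.comp_deterministic_eq_comap, Kernel.comp_assoc]

theorem timeLaw_succ' (t : ℕ) : M.timeLaw π (t + 1) = M.timeLaw π t ∘ₖ M.step π := by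
  induction t with
  | zero => rw [timeLaw_succ, timeLaw_zero, Kernel.comp_id, Kernel.id_comp]
  | succ t ih => rw [timeLaw_succ, ih, ← Kernel.comp_assoc, ← timeLaw_succ, ih]

/-- The law of the rollout when `(o_0, a_0)` is drawn from `μ`. -/
noncomputable def rolloutFrom (μ : Measure (O × A)) : Measure (ℕ → O × A) :=
  M.rolloutFromPair π ∘ₘ μ

/-- The discounted occupancy measure `∑_t γ^t P((o_t, a_t) ∈ ·)` when `(o_0, a_0)` is drawn
from `μ`. -/
noncomputable def occupancy (μ : Measure (O × A)) : Measure (O × A) :=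
  Measure.sum fun t => ENNReal.ofReal (M.γ ^ t) • (M.timeLaw π t ∘ₘ μ)

variable {π}

theorem rolloutFrom_dirac (x : O × A) :
    M.rolloutFrom π (Measure.dirac x) = M.rolloutFromPair π x :=
  Measure.dirac_bind (Kernel.measurable _) x

theorem rolloutFromObs_apply (o : O) :
    M.rolloutFromObs π o = M.rolloutFrom π ((π o).map (Prod.mk o)) := by
  rw [rolloutFromObs, Kernel.comp_apply, rolloutFrom, Kernel.prod_apply, Kernel.id_apply,
    Measure.dirac_prod]

instance (o : O) : IsProbabilityMeasure ((π o).map (Prod.mk o)) :=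
  Measure.isProbabilityMeasure_map (by fun_prop)

theorem rollout_eq : M.rollout π = M.rolloutFrom π (M.init ⊗ₘ π) := by
  rw [rollout, rolloutFromObs, rolloutFrom, Measure.compProd_eq_comp_prod, Measure.comp_assoc]

variable (μ : Measure (O × A))

theorem map_eval_rolloutFrom (t : ℕ) :
    (M.rolloutFrom π μ).map (fun ω => ω t) = M.timeLaw π t ∘ₘ μ :=
  Measure.map_comp _ _ (measurable_pi_apply t)

theorem timeLaw_succ_comp (t : ℕ) :
    M.timeLaw π (t + 1) ∘ₘ μ = M.timeLaw π t ∘ₘ M.step π ∘ₘ μ := by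
  rw [timeLaw_succ', Measure.comp_assoc]

theorem timeLaw_succ_comp' (t : ℕ) :
    M.timeLaw π (t + 1) ∘ₘ μ = M.step π ∘ₘ M.timeLaw π t ∘ₘ μ := by
  rw [timeLaw_succ, Measure.comp_assoc]

theorem occupancy_eq_add_sum :
    M.occupancy π μ = μ + ENNReal.ofReal M.γ •
      Measure.sum fun t => ENNReal.ofReal (M.γ ^ t) • (M.timeLaw π (t + 1) ∘ₘ μ) := by
  ext s hs
  simp only [occupancy, Measure.add_apply, Measure.smul_apply, Measure.sum_apply _ hs, smul_eq_mul]
  rw [tsum_eq_zero_add' ENNReal.summable, ← ENNReal.tsum_mul_left, timeLaw_zero, Measure.id_comp]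
  simp only [pow_zero, ENNReal.ofReal_one, one_mul, pow_succ', ENNReal.ofReal_mul M.γ_nonneg,
    mul_assoc]

theorem occupancy_eq_add_occupancy_step :
    M.occupancy π μ = μ + ENNReal.ofReal M.γ • M.occupancy π (M.step π ∘ₘ μ) := by
  rw [occupancy_eq_add_sum]
  simp only [timeLaw_succ_comp, occupancy]

theorem occupancy_eq_add_step_occupancy :
    M.occupancy π μ = μ + ENNReal.ofReal M.γ • (M.step π ∘ₘ M.occupancy π μ) := by
  conv_lhs => rw [occupancy_eq_add_sum]
  rw [occupancy, Measure.bind_sum _ _ (Kernel.aemeasurable _)]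
  simp only [timeLaw_succ_comp', Measure.comp_smul]

theorem step_comp [SFinite μ] : M.step π ∘ₘ μ = (M.next ∘ₘ μ) ⊗ₘ π := by
  rw [step, Kernel.compProd_prodMkLeft_eq_comp, ← Measure.comp_assoc,
    Measure.compProd_eq_comp_prod]

theorem timeLaw_comp_compProd (t : ℕ) (μ : Measure O) [IsFiniteMeasure μ] :
    M.timeLaw π t ∘ₘ (μ ⊗ₘ π) = (M.timeLaw π t ∘ₘ (μ ⊗ₘ π)).fst ⊗ₘ π := by
  cases t with
  | zero => rw [timeLaw_zero, Measure.id_comp, Measure.fst_compProd]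
  | succ t => rw [timeLaw_succ_comp', step_comp, Measure.fst_compProd]

variable (π) in
theorem visitation_compProd : M.visitation π ⊗ₘ π = M.occupancy π (M.init ⊗ₘ π) := by
  have law_obs (t : ℕ) : (M.rollout π).map (fun ω => (ω t).1) =
      (M.timeLaw π t ∘ₘ (M.init ⊗ₘ π)).fst := by
    rw [← map_eval_rolloutFrom, rollout_eq, Measure.fst,
      Measure.map_map measurable_fst (measurable_pi_apply t)]
    rfl
  simp only [visitation, occupancy, Measure.compProd_sum_left, Measure.compProd_smul_left,
    law_obs, ← timeLaw_comp_compProd]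

/-- The effective horizon `1 / (1 - γ)`, which is the total discount `∑_t γ^t`. -/
noncomputable def horizon : ℝ≥0 :=
  (1 - M.γ)⁻¹.toNNReal

theorem occupancy_univ [IsProbabilityMeasure μ] : M.occupancy π μ Set.univ = M.horizon := by
  simp only [occupancy, Measure.sum_apply _ MeasurableSet.univ, Measure.smul_apply, smul_eq_mul,
    measure_univ, mul_one]
  rw [← ENNReal.ofReal_tsum_of_nonneg (fun t => pow_nonneg M.γ_nonneg t)
    (summable_geometric_of_lt_one M.γ_nonneg M.γ_lt_one),
    tsum_geometric_of_lt_one M.γ_nonneg M.γ_lt_one, horizon, ENNReal.ofReal]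

instance [IsProbabilityMeasure μ] : IsFiniteMeasure (M.occupancy π μ) :=
  ⟨by rw [occupancy_univ]; exact ENNReal.coe_lt_top⟩

variable (π) in
theorem visitation_univ : M.visitation π Set.univ = M.horizon := by
  rw [← M.occupancy_univ (π := π) (M.init ⊗ₘ π), ← visitation_compProd,
    Measure.compProd_apply_univ]

theorem integral_fst_occupancy [IsProbabilityMeasure μ] {f : O → ℝ} (hf : StronglyMeasurable f)
    {β : ℝ} (hβ : ∀ o, |f o| ≤ β) :
    ∫ x, f x.1 ∂M.occupancy π μ =
      ∫ x, f x.1 ∂μ + M.γ * ∫ x, ∫ o, f o ∂M.next x ∂M.occupancy π μ := by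
  have integrable_obs (ν : Measure O) [IsFiniteMeasure ν] : Integrable f ν :=
    Integrable.of_bound hf.aestronglyMeasurable β (.of_forall hβ)
  have integrable_pair (ν : Measure (O × A)) [IsFiniteMeasure ν] : Integrable (fun x => f x.1) ν :=
    Integrable.of_bound (hf.comp_measurable measurable_fst).aestronglyMeasurable β
      (.of_forall fun x => hβ x.1)
  conv_lhs => rw [occupancy_eq_add_step_occupancy]
  rw [integral_add_measure (integrable_pair _)
      ((integrable_pair _).smul_measure ENNReal.ofReal_ne_top),
    integral_smul_measure, ENNReal.toReal_ofReal M.γ_nonneg, smul_eq_mul, step_comp,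
    Measure.integral_compProd (integrable_pair _), ← integral_comp_measure (integrable_obs _)]
  simp

/-! ### Returns as integrals against the occupancy measure -/

theorem measurable_discountedTerm (t : ℕ) :
    Measurable fun ω : ℕ → O × A => M.γ ^ t * M.reward (ω t).1 (ω t).2 :=
  (M.measurable_reward.comp (measurable_pi_apply t)).const_mul _

theorem stronglyMeasurable_discountedReturn : StronglyMeasurable M.discountedReturn :=
  (Measurable.tsum M.measurable_discountedTerm).stronglyMeasurable

theorem lintegral_enorm_discountedTerm (t : ℕ) :
    ∫⁻ ω, ‖M.γ ^ t * M.reward (ω t).1 (ω t).2‖ₑ ∂M.rolloutFrom π μ =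
      ENNReal.ofReal (M.γ ^ t) * ∫⁻ x, ‖M.reward x.1 x.2‖ₑ ∂(M.timeLaw π t ∘ₘ μ) := by
  rw [← map_eval_rolloutFrom, lintegral_map M.measurable_reward.enorm (measurable_pi_apply t),
    ← lintegral_const_mul' _ _ ENNReal.ofReal_ne_top]
  simp only [enorm_mul, Real.enorm_of_nonneg (pow_nonneg M.γ_nonneg t)]

theorem integral_discountedTerm (t : ℕ) :
    ∫ ω, M.γ ^ t * M.reward (ω t).1 (ω t).2 ∂M.rolloutFrom π μ =
      M.γ ^ t * ∫ x, M.reward x.1 x.2 ∂(M.timeLaw π t ∘ₘ μ) := by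
  rw [integral_const_mul, ← map_eval_rolloutFrom, integral_map
    (measurable_pi_apply t).aemeasurable M.measurable_reward.aestronglyMeasurable]

theorem tsum_lintegral_enorm_discountedTerm :
    ∑' t, ∫⁻ ω, ‖M.γ ^ t * M.reward (ω t).1 (ω t).2‖ₑ ∂M.rolloutFrom π μ =
      ∫⁻ x, ‖M.reward x.1 x.2‖ₑ ∂M.occupancy π μ := by
  simp only [occupancy, lintegral_sum_measure, lintegral_smul_measure, smul_eq_mul,
    lintegral_enorm_discountedTerm]

theorem lintegral_absReturn :
    ∫⁻ ω, M.absReturn ω ∂M.rolloutFrom π μ = ∫⁻ x, ‖M.reward x.1 x.2‖ₑ ∂M.occupancy π μ := by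
  unfold absReturn
  rw [lintegral_tsum fun t => (M.measurable_discountedTerm t).enorm.aemeasurable,
    tsum_lintegral_enorm_discountedTerm]

variable {M μ}

theorem integrable_discountedReturn
    (h : Integrable (fun x : O × A => M.reward x.1 x.2) (M.occupancy π μ)) :
    Integrable M.discountedReturn (M.rolloutFrom π μ) :=
  ⟨M.stronglyMeasurable_discountedReturn.aestronglyMeasurable,
    (lintegral_mono fun _ => enorm_tsum_le_tsum_enorm).trans_lt
      ((M.lintegral_absReturn μ).trans_lt h.2)⟩

theorem integral_discountedReturn
    (h : Integrable (fun x : O × A => M.reward x.1 x.2) (M.occupancy π μ)) :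
    ∫ ω, M.discountedReturn ω ∂M.rolloutFrom π μ =
      ∫ x, M.reward x.1 x.2 ∂M.occupancy π μ := by
  unfold discountedReturn
  rw [integral_tsum fun t => (M.measurable_discountedTerm t).aestronglyMeasurable]
  · simp only [integral_discountedTerm]
    rw [occupancy, integral_sum_measure h]
    simp only [integral_smul_measure, ENNReal.toReal_ofReal (pow_nonneg M.γ_nonneg _), smul_eq_mul]
  · rw [tsum_lintegral_enorm_discountedTerm]
    exact h.2.ne

end Occupancy

section Value

variable {O A : Type*} [MeasurableSpace O] [MeasurableSpace A]
variable (M : MDP O A) (π : Kernel O A) [IsMarkovKernel π]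

theorem stronglyMeasurable_qValue : StronglyMeasurable fun x : O × A => M.qValue π x.1 x.2 :=
  M.stronglyMeasurable_discountedReturn.integral_kernel

theorem stronglyMeasurable_value : StronglyMeasurable (M.value π) :=
  M.stronglyMeasurable_discountedReturn.integral_kernel

theorem stronglyMeasurable_advantage :
    StronglyMeasurable fun x : O × A => M.advantage π x.1 x.2 :=
  (M.stronglyMeasurable_qValue π).sub
    ((M.stronglyMeasurable_value π).comp_measurable measurable_fst)

end Value

end MDP

/-! ### The performance difference lemma -/

namespace MDP

variable {O A : Type*} [MeasurableSpace O] [MeasurableSpace A]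

/-- The weight `w` dominates the reward, and the policy `π` integrates it to at most `B` whatever
the observation. This is the integrability condition under which the value functions exist. -/
structure DominatedBy (M : MDP O A) (π : Kernel O A) (w : A → ℝ≥0) (B : ℝ≥0) : Prop where
  measurable_weight : Measurable w
  nnnorm_reward_le : ∀ o a, ‖M.reward o a‖₊ ≤ w a
  lintegral_weight_le : ∀ o, ∫⁻ a, w a ∂π o ≤ B

namespace DominatedBy

variable {M : MDP O A} {π π' : Kernel O A} {w : A → ℝ≥0} {B : ℝ≥0}

theorem measurable_weight_snd (h : M.DominatedBy π w B) :
    Measurable fun x : O × A => (w x.2 : ℝ≥0∞) :=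
  (h.measurable_weight.comp measurable_snd).coe_nnreal_ennreal

theorem integrable_of_abs_le (h : M.DominatedBy π w B) {ν : Measure (O × A)} [IsFiniteMeasure ν]
    (hν : ∫⁻ x, w x.2 ∂ν < ∞) {f : O × A → ℝ} (hf : StronglyMeasurable f) {c : ℝ}
    (hc : ∀ x, |f x| ≤ w x.2 + c) : Integrable f ν := by
  have integrable_weight : Integrable (fun x : O × A => (w x.2 : ℝ)) ν :=
    ⟨(h.measurable_weight.comp measurable_snd).coe_nnreal_real.aestronglyMeasurable, by
      simpa [HasFiniteIntegral] using hν⟩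
  exact (integrable_weight.add (integrable_const c)).mono' hf.aestronglyMeasurable (.of_forall hc)

theorem lintegral_weight_dirac (h : M.DominatedBy π w B) (x : O × A) :
    ∫⁻ y, w y.2 ∂Measure.dirac x = w x.2 :=
  lintegral_dirac' _ h.measurable_weight_snd

theorem lintegral_weight_map_mk_le (h : M.DominatedBy π w B) (o : O) :
    ∫⁻ y, w y.2 ∂(π o).map (Prod.mk o) ≤ B := by
  rw [lintegral_map h.measurable_weight_snd measurable_prodMk_left]
  exact h.lintegral_weight_le o

theorem lintegral_enorm_reward_le (h : M.DominatedBy π w B) (μ : Measure (O × A)) :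
    ∫⁻ x, ‖M.reward x.1 x.2‖ₑ ∂μ ≤ ∫⁻ x, w x.2 ∂μ :=
  lintegral_mono fun x => ENNReal.coe_le_coe.2 (h.nnnorm_reward_le x.1 x.2)

theorem integrable_reward (h : M.DominatedBy π w B) {μ : Measure (O × A)}
    (hμ : ∫⁻ x, w x.2 ∂μ < ∞) : Integrable (fun x : O × A => M.reward x.1 x.2) μ :=
  ⟨M.measurable_reward.aestronglyMeasurable, (h.lintegral_enorm_reward_le μ).trans_lt hμ⟩

variable [IsMarkovKernel π] [IsMarkovKernel π']

theorem lintegral_weight_compProd_lt_top (h : M.DominatedBy π w B) (μ : Measure O)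
    [IsFiniteMeasure μ] : ∫⁻ x, w x.2 ∂(μ ⊗ₘ π) < ∞ := by
  rw [Measure.lintegral_compProd h.measurable_weight_snd]
  exact (lintegral_mono h.lintegral_weight_le).trans_lt <| by
    simpa using ENNReal.mul_lt_top ENNReal.coe_lt_top (measure_lt_top μ Set.univ)

theorem lintegral_weight_step_le (h : M.DominatedBy π w B) (x : O × A) :
    ∫⁻ y, w y.2 ∂M.step π x ≤ B := by
  rw [step, Kernel.lintegral_compProd _ _ _ h.measurable_weight_snd]
  exact (lintegral_mono h.lintegral_weight_le).trans (by simp)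

theorem lintegral_weight_occupancy_le (h : M.DominatedBy π w B) (μ : Measure (O × A))
    [IsProbabilityMeasure μ] :
    ∫⁻ x, w x.2 ∂M.occupancy π μ ≤ ∫⁻ x, w x.2 ∂μ + B * M.horizon := by
  rw [occupancy_eq_add_step_occupancy, lintegral_add_measure, lintegral_smul_measure,
    Measure.lintegral_bind (Kernel.aemeasurable _) h.measurable_weight_snd.aemeasurable]
  gcongr
  calc ENNReal.ofReal M.γ * ∫⁻ x, ∫⁻ y, w y.2 ∂M.step π x ∂M.occupancy π μ
      ≤ 1 * ∫⁻ _, (B : ℝ≥0∞) ∂M.occupancy π μ := by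
        gcongr
        · exact ENNReal.ofReal_le_one.2 M.γ_lt_one.le
        · exact h.lintegral_weight_step_le _
    _ = B * M.horizon := by rw [lintegral_const, occupancy_univ, one_mul]

theorem lintegral_weight_occupancy_lt_top (h : M.DominatedBy π w B) {μ : Measure (O × A)}
    [IsProbabilityMeasure μ] (hμ : ∫⁻ x, w x.2 ∂μ < ∞) : ∫⁻ x, w x.2 ∂M.occupancy π μ < ∞ :=
  (h.lintegral_weight_occupancy_le μ).trans_lt <|
    ENNReal.add_lt_top.2 ⟨hμ, ENNReal.mul_lt_top ENNReal.coe_lt_top ENNReal.coe_lt_top⟩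

theorem integrable_reward_occupancy (h : M.DominatedBy π w B) {μ : Measure (O × A)}
    [IsProbabilityMeasure μ] (hμ : ∫⁻ x, w x.2 ∂μ < ∞) :
    Integrable (fun x : O × A => M.reward x.1 x.2) (M.occupancy π μ) :=
  h.integrable_reward (h.lintegral_weight_occupancy_lt_top hμ)

theorem lintegral_absReturn_lt_top (h : M.DominatedBy π w B) {μ : Measure (O × A)}
    [IsProbabilityMeasure μ] (hμ : ∫⁻ x, w x.2 ∂μ < ∞) :
    ∫⁻ ω, M.absReturn ω ∂M.rolloutFrom π μ < ∞ :=
  (M.lintegral_absReturn μ).trans_lt (h.integrable_reward_occupancy hμ).2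

theorem abs_integral_reward_occupancy_le (h : M.DominatedBy π w B) {μ : Measure (O × A)}
    [IsProbabilityMeasure μ] {c : ℝ≥0} (hμ : ∫⁻ x, w x.2 ∂μ ≤ c) :
    |∫ x, M.reward x.1 x.2 ∂M.occupancy π μ| ≤ c + B * M.horizon := by
  have enorm_le := calc ‖(∫ x, M.reward x.1 x.2 ∂M.occupancy π μ)‖ₑ
    _ ≤ ∫⁻ x, ‖M.reward x.1 x.2‖ₑ ∂M.occupancy π μ := enorm_integral_le_lintegral_enorm _
    _ ≤ ∫⁻ x, w x.2 ∂M.occupancy π μ := h.lintegral_enorm_reward_le _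
    _ ≤ c + B * M.horizon :=
        (h.lintegral_weight_occupancy_le μ).trans (by gcongr)
    _ = (c + B * M.horizon : ℝ≥0) := by push_cast; rfl
  exact_mod_cast ENNReal.coe_le_coe.1 enorm_le

theorem qValue_eq_integral_occupancy (h : M.DominatedBy π w B) (o : O) (a : A) :
    M.qValue π o a = ∫ x, M.reward x.1 x.2 ∂M.occupancy π (Measure.dirac (o, a)) := by
  rw [qValue, ← rolloutFrom_dirac, integral_discountedReturn (h.integrable_reward_occupancy
    ((h.lintegral_weight_dirac _).trans_lt ENNReal.coe_lt_top))]

theorem value_eq_integral_occupancy (h : M.DominatedBy π w B) (o : O) :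
    M.value π o = ∫ x, M.reward x.1 x.2 ∂M.occupancy π ((π o).map (Prod.mk o)) := by
  rw [value, rolloutFromObs_apply, integral_discountedReturn (h.integrable_reward_occupancy
    ((h.lintegral_weight_map_mk_le o).trans_lt ENNReal.coe_lt_top))]

theorem J_eq_integral_occupancy (h : M.DominatedBy π w B) :
    M.J π = ∫ x, M.reward x.1 x.2 ∂(M.visitation π ⊗ₘ π) := by
  rw [J, rollout_eq, visitation_compProd, integral_discountedReturn (h.integrable_reward_occupancy
    (h.lintegral_weight_compProd_lt_top M.init))]

theorem integral_reward_occupancy_eq (h : M.DominatedBy π w B) {μ : Measure (O × A)}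
    [IsProbabilityMeasure μ] (hμ : ∫⁻ x, w x.2 ∂μ < ∞) :
    ∫ x, M.reward x.1 x.2 ∂M.occupancy π μ = ∫ x, M.qValue π x.1 x.2 ∂μ := by
  have integrable_reward := h.integrable_reward_occupancy hμ
  rw [← integral_discountedReturn integrable_reward]
  exact integral_comp_measure (integrable_discountedReturn integrable_reward)

theorem abs_qValue_le (h : M.DominatedBy π w B) (o : O) (a : A) :
    |M.qValue π o a| ≤ w a + B * M.horizon := by
  rw [h.qValue_eq_integral_occupancy]
  exact h.abs_integral_reward_occupancy_le (h.lintegral_weight_dirac _).le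

theorem abs_value_le (h : M.DominatedBy π w B) (o : O) :
    |M.value π o| ≤ B + B * M.horizon := by
  rw [h.value_eq_integral_occupancy]
  exact h.abs_integral_reward_occupancy_le (h.lintegral_weight_map_mk_le o)

theorem abs_advantage_le (h : M.DominatedBy π w B) (o : O) (a : A) :
    |M.advantage π o a| ≤ w a + (B + 2 * (B * M.horizon)) := calc
  |M.advantage π o a| ≤ |M.qValue π o a| + |M.value π o| := abs_sub _ _
  _ ≤ _ := add_le_add (h.abs_qValue_le o a) (h.abs_value_le o)
  _ = _ := by ring

theorem abs_advantage_le_mul (h : M.DominatedBy π w B) (hw : ∀ a, 1 ≤ w a) (o : O) (a : A) :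
    |M.advantage π o a| ≤ (1 + (B + 2 * (B * M.horizon)) : ℝ≥0) * w a := by
  have bound_le : B + 2 * (B * M.horizon) ≤ (B + 2 * (B * M.horizon)) * w a :=
    le_mul_of_one_le_right' (hw a)
  calc |M.advantage π o a| ≤ w a + (B + 2 * (B * M.horizon) : ℝ≥0) := by
        exact_mod_cast h.abs_advantage_le o a
    _ ≤ w a + ((B + 2 * (B * M.horizon)) * w a : ℝ≥0) := by gcongr
    _ = (1 + (B + 2 * (B * M.horizon)) : ℝ≥0) * w a := by push_cast; ring

theorem integrable_qValue (h : M.DominatedBy π w B) {ν : Measure (O × A)} [IsFiniteMeasure ν]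
    (hν : ∫⁻ x, w x.2 ∂ν < ∞) : Integrable (fun x : O × A => M.qValue π x.1 x.2) ν :=
  h.integrable_of_abs_le hν (M.stronglyMeasurable_qValue π) fun x => h.abs_qValue_le x.1 x.2

theorem integrable_advantage (h : M.DominatedBy π w B) {ν : Measure (O × A)} [IsFiniteMeasure ν]
    (hν : ∫⁻ x, w x.2 ∂ν < ∞) : Integrable (fun x : O × A => M.advantage π x.1 x.2) ν :=
  h.integrable_of_abs_le hν (M.stronglyMeasurable_advantage π) fun x => h.abs_advantage_le x.1 x.2

theorem value_eq_integral_qValue (h : M.DominatedBy π w B) (o : O) :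
    M.value π o = ∫ a, M.qValue π o a ∂π o := by
  rw [h.value_eq_integral_occupancy, h.integral_reward_occupancy_eq
    ((h.lintegral_weight_map_mk_le o).trans_lt ENNReal.coe_lt_top), integral_map (by fun_prop)
    (M.stronglyMeasurable_qValue π).aestronglyMeasurable]

theorem J_eq_integral_value (h : M.DominatedBy π w B) : M.J π = ∫ o, M.value π o ∂M.init := by
  have weight_lt_top := h.lintegral_weight_compProd_lt_top M.init
  rw [h.J_eq_integral_occupancy, visitation_compProd, h.integral_reward_occupancy_eq weight_lt_top,
    Measure.integral_compProd (h.integrable_qValue weight_lt_top)]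
  simp only [h.value_eq_integral_qValue]

theorem qValue_eq_reward_add (h : M.DominatedBy π w B) (o : O) (a : A) :
    M.qValue π o a = M.reward o a + M.γ * ∫ o', M.value π o' ∂M.next (o, a) := by
  have step_lt_top := (h.lintegral_weight_step_le (o, a)).trans_lt ENNReal.coe_lt_top
  have dirac_lt_top := (h.lintegral_weight_dirac (o, a)).trans_lt ENNReal.coe_lt_top
  have unfold_occupancy : M.occupancy π (Measure.dirac (o, a)) =
      Measure.dirac (o, a) + ENNReal.ofReal M.γ • M.occupancy π (M.step π (o, a)) := by
    rw [occupancy_eq_add_occupancy_step, Measure.dirac_bind (Kernel.measurable _)]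
  rw [h.qValue_eq_integral_occupancy, unfold_occupancy,
    integral_add_measure (h.integrable_reward dirac_lt_top)
      ((h.integrable_reward_occupancy step_lt_top).smul_measure ENNReal.ofReal_ne_top),
    integral_dirac' _ _ M.measurable_reward.stronglyMeasurable, integral_smul_measure,
    ENNReal.toReal_ofReal M.γ_nonneg, smul_eq_mul, h.integral_reward_occupancy_eq step_lt_top, step,
    ProbabilityTheory.integral_compProd (h.integrable_qValue step_lt_top)]
  simp only [h.value_eq_integral_qValue, Kernel.prodMkLeft_apply]

theorem integral_advantage_eq_zero (h : M.DominatedBy π w B) (o : O) :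
    ∫ a, M.advantage π o a ∂π o = 0 := by
  have integrable_qValue : Integrable (fun a => M.qValue π o a) (π o) :=
    (h.integrable_qValue ((h.lintegral_weight_map_mk_le o).trans_lt
      ENNReal.coe_lt_top)).comp_measurable measurable_prodMk_left
  simp [advantage, integral_sub integrable_qValue, ← h.value_eq_integral_qValue]

theorem J_sub_J_eq_integral_advantage (h : M.DominatedBy π w B) (h' : M.DominatedBy π' w B) :
    M.J π' - M.J π = ∫ x, M.advantage π x.1 x.2 ∂(M.visitation π' ⊗ₘ π') := by
  have flow := M.integral_fst_occupancy (π := π') (M.init ⊗ₘ π') (M.stronglyMeasurable_value π)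
    h.abs_value_le
  have integrable_value (ν : Measure (O × A)) [IsFiniteMeasure ν] :
      Integrable (fun x => M.value π x.1) ν :=
    Integrable.of_bound ((M.stronglyMeasurable_value π).comp_measurable
      measurable_fst).aestronglyMeasurable _ (.of_forall fun x => h.abs_value_le x.1)
  rw [Measure.integral_compProd (integrable_value _)] at flow
  rw [h'.J_eq_integral_occupancy, h.J_eq_integral_value, visitation_compProd]
  have weight_lt_top := h'.lintegral_weight_occupancy_lt_top
    (h'.lintegral_weight_compProd_lt_top M.init)
  set ν := M.occupancy π' (M.init ⊗ₘ π')
  have integral_qValue : ∫ x, M.qValue π x.1 x.2 ∂ν = ∫ x, M.reward x.1 x.2 ∂ν +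
      M.γ * ∫ x, ∫ o, M.value π o ∂M.next x ∂ν := by
    have integrable_next : Integrable (fun x => M.γ * ∫ o, M.value π o ∂M.next x) ν :=
      ((h.integrable_qValue weight_lt_top).sub (h'.integrable_reward weight_lt_top)).congr
        (.of_forall fun x => by simp [h.qValue_eq_reward_add])
    simp only [h.qValue_eq_reward_add]
    rw [integral_add (h'.integrable_reward weight_lt_top) integrable_next, integral_const_mul]
  simp only [advantage]
  rw [integral_sub (h.integrable_qValue weight_lt_top) (integrable_value _), integral_qValue, flow]
  simp

end DominatedBy

end MDP

/-! ### Second-order expansion of the expected return -/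

/-- The kernels `κ` and `κ'` are within `δ` of each other in `w`-weighted total variation distance,
uniformly in the source: integrals of functions bounded by `c * w` differ by at most `c * δ`. -/
def WeightedTVDistLE {O X : Type*} [MeasurableSpace O] [MeasurableSpace X] (w : X → ℝ≥0)
    (κ κ' : Kernel O X) (δ : ℝ≥0) : Prop :=
  ∀ ⦃f : X → ℝ⦄, Measurable f → ∀ ⦃c : ℝ≥0⦄, (∀ x, |f x| ≤ c * w x) →
    ∀ o, |∫ x, f x ∂κ' o - ∫ x, f x ∂κ o| ≤ c * δ

theorem WeightedTVDistLE.map {O X Y : Type*} [MeasurableSpace O] [MeasurableSpace X]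
    [MeasurableSpace Y] {κ κ' : Kernel O X} {g : X → Y} (hg : Measurable g) {w : Y → ℝ≥0} {δ : ℝ≥0}
    (h : WeightedTVDistLE (fun x => w (g x)) κ κ' δ) :
    WeightedTVDistLE w (κ.map g) (κ'.map g) δ := by
  intro f hf c hc o
  simp only [Kernel.map_apply _ hg, integral_map hg.aemeasurable hf.aestronglyMeasurable]
  exact h (hf.comp hg) (fun x => hc (g x)) o

namespace MDP

variable {O A : Type*} [MeasurableSpace O] [MeasurableSpace A]

/-- The environment of `M` with reward `f o`. Its expected return is the integral of `f` against
the visitation measure of `M`, so that the performance difference lemma for it compares visitation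
measures. -/
def withObsReward (M : MDP O A) (f : O → ℝ) (hf : Measurable f) : MDP O A where
  __ := M
  reward o _ := f o
  measurable_reward := hf.comp measurable_fst

variable {M : MDP O A} {π π' : Kernel O A} [IsMarkovKernel π] [IsMarkovKernel π']
  {w : A → ℝ≥0} {B δ : ℝ≥0}

section WithObsReward

variable {f : O → ℝ} {hf : Measurable f} {β : ℝ≥0}

theorem dominatedBy_withObsReward (hβ : ∀ o, |f o| ≤ β) :
    (M.withObsReward f hf).DominatedBy π (fun _ => β) β where
  measurable_weight := measurable_const
  nnnorm_reward_le o _ := hβ o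
  lintegral_weight_le o := by simp

theorem J_withObsReward (hβ : ∀ o, |f o| ≤ β) :
    (M.withObsReward f hf).J π = ∫ o, f o ∂M.visitation π := by
  rw [(dominatedBy_withObsReward hβ).J_eq_integral_occupancy]
  change ∫ x : O × A, f x.1 ∂(M.visitation π ⊗ₘ π) = _
  rw [Measure.integral_compProd]
  · simp
  · exact Integrable.of_bound (hf.comp measurable_fst).aestronglyMeasurable β
      (.of_forall fun x => hβ x.1)

end WithObsReward

variable (M) in
theorem abs_integral_visitation_le {f : O → ℝ} {β : ℝ} (hβ : ∀ o, |f o| ≤ β) :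
    |∫ o, f o ∂M.visitation π| ≤ β * M.horizon := by
  have visitation_real_univ : (M.visitation π).real Set.univ = M.horizon := by
    rw [measureReal_def, visitation_univ, ENNReal.coe_toReal]
  rw [← visitation_real_univ]
  exact norm_integral_le_of_norm_le_const (f := f) (.of_forall hβ)

variable (M) in
theorem abs_integral_visitation_sub_le (hw : ∀ a, 1 ≤ w a) (hd : WeightedTVDistLE w π π' δ)
    {f : O → ℝ} (hf : Measurable f) {β : ℝ≥0} (hβ : ∀ o, |f o| ≤ β) :
    |∫ o, f o ∂M.visitation π' - ∫ o, f o ∂M.visitation π| ≤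
      2 * β * (1 + M.horizon) * δ * M.horizon := by
  let N := M.withObsReward f hf
  have h : N.DominatedBy π (fun _ => β) β := dominatedBy_withObsReward hβ
  have h' : N.DominatedBy π' (fun _ => β) β := dominatedBy_withObsReward hβ
  have advantage_le (o : O) (a : A) :
      |N.advantage π o a| ≤ (2 * β * (1 + M.horizon) : ℝ≥0) * w a := calc
    |N.advantage π o a| ≤ β + (β + 2 * (β * M.horizon)) := h.abs_advantage_le o a
    _ = (2 * β * (1 + M.horizon) : ℝ≥0) := by push_cast; ring
    _ ≤ _ := le_mul_of_one_le_right (by positivity) (hw a)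
  have advantage_integral_le (o : O) :
      |∫ a, N.advantage π o a ∂π' o| ≤ (2 * β * (1 + M.horizon) : ℝ≥0) * δ := by
    simpa [h.integral_advantage_eq_zero] using
      hd ((N.stronglyMeasurable_advantage π).measurable.comp measurable_prodMk_left)
        (advantage_le o) o
  rw [← J_withObsReward (hf := hf) hβ, ← J_withObsReward (hf := hf) hβ,
    h.J_sub_J_eq_integral_advantage h', Measure.integral_compProd
      (h.integrable_advantage (h'.lintegral_weight_compProd_lt_top _))]
  exact_mod_cast N.abs_integral_visitation_le advantage_integral_le

theorem DominatedBy.abs_J_sub_sub_le (h : M.DominatedBy π w B) (h' : M.DominatedBy π' w B)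
    (hw : ∀ a, 1 ≤ w a) (hd : WeightedTVDistLE w π π' δ) :
    |M.J π' - M.J π - ∫ x, M.advantage π x.1 x.2 ∂(M.visitation π ⊗ₘ π')| ≤
      2 * (1 + (B + 2 * (B * M.horizon))) * (1 + M.horizon) * M.horizon * δ ^ 2 := by
  have advantage_integral_le (o : O) :
      |∫ a, M.advantage π o a ∂π' o| ≤ ((1 + (B + 2 * (B * M.horizon))) * δ : ℝ≥0) := by
    simpa [h.integral_advantage_eq_zero] using
      hd ((M.stronglyMeasurable_advantage π).measurable.comp measurable_prodMk_left)
        (h.abs_advantage_le_mul hw o) o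
  have integrable_advantage (μ : Measure O) [IsFiniteMeasure μ] :=
    h.integrable_advantage (h'.lintegral_weight_compProd_lt_top μ)
  rw [h.J_sub_J_eq_integral_advantage h', Measure.integral_compProd (integrable_advantage _),
    Measure.integral_compProd (integrable_advantage _)]
  refine (M.abs_integral_visitation_sub_le hw hd
    (M.stronglyMeasurable_advantage π).integral_kernel_prod_right'.measurable
    advantage_integral_le).trans_eq ?_
  push_cast
  ring

theorem hasFDerivAt_J {E : Type*} [NormedAddCommGroup E] [NormedSpace ℝ E] {π : E → Kernel O A}
    [∀ ϑ, IsMarkovKernel (π ϑ)] {θ : E} {L : ℝ≥0} {J' : E →L[ℝ] ℝ} (hw : ∀ a, 1 ≤ w a)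
    (hdom : ∀ᶠ ϑ in nhds θ, M.DominatedBy (π ϑ) w B)
    (hd : ∀ᶠ ϑ in nhds θ, WeightedTVDistLE w (π θ) (π ϑ) (L * ‖ϑ - θ‖₊))
    (hJ' : HasFDerivAt (fun ϑ =>
      ∫ x, M.advantage (π θ) x.1 x.2 ∂(M.visitation (π θ) ⊗ₘ π ϑ)) J' θ) :
    HasFDerivAt (fun ϑ => M.J (π ϑ)) J' θ := by
  have h := hdom.self_of_nhds
  set Φ : E → ℝ := fun ϑ => ∫ x, M.advantage (π θ) x.1 x.2 ∂(M.visitation (π θ) ⊗ₘ π ϑ)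
  have eq_zero : Φ θ = 0 := by
    simp [Φ, Measure.integral_compProd (h.integrable_advantage
      (h.lintegral_weight_compProd_lt_top _)), h.integral_advantage_eq_zero]
  have remainder_isBigO :
      (fun ϑ => M.J (π ϑ) - M.J (π θ) - Φ ϑ) =O[nhds θ] fun ϑ => ‖ϑ - θ‖ ^ 2 := by
    refine .of_bound (2 * (1 + (B + 2 * (B * M.horizon))) * (1 + M.horizon) * M.horizon * L ^ 2) ?_
    filter_upwards [hdom, hd] with ϑ h' hd
    refine (h.abs_J_sub_sub_le h' hw hd).trans_eq ?_
    rw [Real.norm_of_nonneg (by positivity)]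
    push_cast
    ring
  rw [hasFDerivAt_iff_isLittleO] at hJ' ⊢
  refine ((remainder_isBigO.trans_isLittleO
    (Asymptotics.isLittleO_pow_sub_sub θ one_lt_two)).add hJ').congr_left fun ϑ => ?_
  rw [eq_zero]
  ring

end MDP

/-! ### Differentiation of dominated densities -/

theorem countable_of_orthonormal {ι E : Type*} [NormedAddCommGroup E]
    [InnerProductSpace ℝ E] [TopologicalSpace.SeparableSpace E] {v : ι → E}
    (hv : Orthonormal ℝ v) : Countable ι := by
  refine Pairwise.countable_of_isOpen_disjoint (s := fun i => Metric.ball (v i) (1 / 2))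
    (fun i j hij => Metric.ball_disjoint_ball ?_) (fun i => Metric.isOpen_ball)
    fun i => Metric.nonempty_ball.2 (by norm_num)
  have sq_dist : dist (v i) (v j) ^ 2 = 2 := by
    rw [dist_eq_norm, norm_sub_sq_real, hv.norm_eq_one, hv.norm_eq_one, hv.inner_eq_zero hij]
    norm_num
  nlinarith [dist_nonneg (x := v i) (y := v j)]

theorem stronglyMeasurable_gradient {X E : Type*} [MeasurableSpace X] [NormedAddCommGroup E]
    [InnerProductSpace ℝ E] [CompleteSpace E] [TopologicalSpace.SeparableSpace E]
    {f : E → X → ℝ} {θ : E} (hf : ∀ ϑ, Measurable (f ϑ))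
    (hd : ∀ x, DifferentiableAt ℝ (fun ϑ => f ϑ x) θ) :
    StronglyMeasurable fun x => gradient (fun ϑ => f ϑ x) θ := by
  have measurable_inner (v : E) : Measurable fun x => ⟪v, gradient (fun ϑ => f ϑ x) θ⟫ := by
    refine measurable_of_tendsto_metrizable (f := fun (n : ℕ) x =>
      (n : ℝ) • (f (θ + (n : ℝ)⁻¹ • v) x - f θ x))
      (fun n => ((hf _).sub (hf θ)).const_smul (n : ℝ)) (tendsto_pi_nhds.2 fun x => ?_)
    have norm_natCast_tendsto :
        Filter.Tendsto (fun n : ℕ => ‖(n : ℝ)‖) Filter.atTop Filter.atTop := by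
      simpa using tendsto_natCast_atTop_atTop (R := ℝ)
    simpa [real_inner_comm] using (hd x).hasGradientAt.hasFDerivAt.lim v norm_natCast_tendsto
  obtain ⟨w, b, -⟩ := exists_hilbertBasis ℝ E
  have := countable_of_orthonormal b.orthonormal
  refine stronglyMeasurable_of_tendsto (Filter.atTop (α := Finset w))
    (f := fun s x => ∑ i ∈ s, ⟪b i, gradient (fun ϑ => f ϑ x) θ⟫ • b i)
    (fun s => Finset.stronglyMeasurable_fun_sum s fun i _ =>
      (measurable_inner (b i)).stronglyMeasurable.smul_const (b i))
    (tendsto_pi_nhds.2 fun x => ?_)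
  simpa only [HasSum, SummationFilter.unconditional_filter, b.repr_apply_apply] using
    b.hasSum_repr (gradient (fun ϑ => f ϑ x) θ)

section Exp

variable {X F : Type*} [MeasurableSpace X] {ν : Measure X} [NormedAddCommGroup F] [NormedSpace ℝ F]
  {f : X → ℝ}

theorem integral_withDensity_exp (hf : Measurable f) (g : X → F) :
    ∫ x, g x ∂ν.withDensity (fun x => ENNReal.ofReal (Real.exp (f x))) =
      ∫ x, Real.exp (f x) • g x ∂ν := by
  simp [integral_withDensity_eq_integral_toReal_smul hf.exp.ennreal_ofReal,
    ENNReal.toReal_ofReal (Real.exp_nonneg _)]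

theorem integrable_withDensity_exp_iff (hf : Measurable f) {g : X → F} :
    Integrable g (ν.withDensity fun x => ENNReal.ofReal (Real.exp (f x))) ↔
      Integrable (fun x => Real.exp (f x) • g x) ν := by
  simp [integrable_withDensity_iff_integrable_smul' hf.exp.ennreal_ofReal,
    ENNReal.toReal_ofReal (Real.exp_nonneg _)]

end Exp

/-- A family of kernels `κ ϑ` with log-densities `ℓ ϑ` with respect to a fixed measure `ν`, which
for `ϑ` in a ball around `θ` are differentiable in `ϑ` and such that the density and its derivative
`exp ℓ • fderiv ℓ`, multiplied by the weight `w`, are bounded by an integrable function `b` that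
depends neither on `ϑ` nor on the point at which the kernel is evaluated. -/
structure DominatedLogDensity {O X E : Type*} [MeasurableSpace O] [MeasurableSpace X]
    [NormedAddCommGroup E] [NormedSpace ℝ E] (κ : E → Kernel O X) (ν : Measure X) [SFinite ν]
    (ℓ : E → O → X → ℝ) (w : X → ℝ≥0) (b : X → ℝ) (θ : E) (ε : ℝ) : Prop where
  pos : 0 < ε
  measurable_logDensity : ∀ ϑ, Measurable (Function.uncurry (ℓ ϑ))
  eq_withDensity : ∀ ϑ, κ ϑ =
    (Kernel.const O ν).withDensity fun o x => ENNReal.ofReal (Real.exp (ℓ ϑ o x))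
  measurable_weight : Measurable w
  integrable_bound : Integrable b ν
  differentiableAt : ∀ ϑ ∈ Metric.ball θ ε, ∀ o x, DifferentiableAt ℝ (fun ϑ => ℓ ϑ o x) ϑ
  weight_mul_le : ∀ ϑ ∈ Metric.ball θ ε, ∀ o x,
    w x * (Real.exp (ℓ ϑ o x) * (1 + ‖fderiv ℝ (fun ϑ => ℓ ϑ o x) ϑ‖)) ≤ b x

namespace DominatedLogDensity

variable {O X E : Type*} [MeasurableSpace O] [MeasurableSpace X] [NormedAddCommGroup E]

section NormedSpace

variable [NormedSpace ℝ E] {κ : E → Kernel O X} {ν : Measure X} [SFinite ν] {ℓ : E → O → X → ℝ}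
  {w : X → ℝ≥0} {b : X → ℝ} {θ ϑ : E} {ε : ℝ}

theorem apply (h : DominatedLogDensity κ ν ℓ w b θ ε) (ϑ : E) (o : O) :
    κ ϑ o = ν.withDensity fun x => ENNReal.ofReal (Real.exp (ℓ ϑ o x)) := by
  rw [h.eq_withDensity, Kernel.withDensity_apply _ (h.measurable_logDensity ϑ).exp.ennreal_ofReal,
    Kernel.const_apply]

theorem isSFiniteKernel (h : DominatedLogDensity κ ν ℓ w b θ ε) (ϑ : E) :
    IsSFiniteKernel (κ ϑ) := by
  rw [h.eq_withDensity]
  exact Kernel.IsSFiniteKernel.withDensity _ fun _ _ => ENNReal.ofReal_ne_top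

theorem compProd_eq (h : DominatedLogDensity κ ν ℓ w b θ ε) (ϑ : E) (μ : Measure O) [SFinite μ] :
    μ ⊗ₘ κ ϑ =
      (μ.prod ν).withDensity fun y => ENNReal.ofReal (Real.exp (Function.uncurry (ℓ ϑ) y)) := by
  have := h.isSFiniteKernel ϑ
  rw [h.eq_withDensity] at this ⊢
  rw [Measure.compProd_withDensity (h.measurable_logDensity ϑ).exp.ennreal_ofReal,
    Measure.compProd_const]
  rfl

theorem weight_mul_exp_le (h : DominatedLogDensity κ ν ℓ w b θ ε) (hϑ : ϑ ∈ Metric.ball θ ε)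
    (o : O) (x : X) : w x * Real.exp (ℓ ϑ o x) ≤ b x := by
  refine le_trans ?_ (h.weight_mul_le ϑ hϑ o x)
  gcongr
  exact le_mul_of_one_le_right (Real.exp_nonneg _) (le_add_of_nonneg_right (norm_nonneg _))

theorem norm_exp_smul_le (h : DominatedLogDensity κ ν ℓ w b θ ε) (hϑ : ϑ ∈ Metric.ball θ ε) (o : O)
    {x : X} {c : ℝ≥0} {r : ℝ} (hr : |r| ≤ c * w x) : ‖Real.exp (ℓ ϑ o x) • r‖ ≤ c * b x :=
  calc ‖Real.exp (ℓ ϑ o x) • r‖ = Real.exp (ℓ ϑ o x) * |r| := by simp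
    _ ≤ Real.exp (ℓ ϑ o x) * (c * w x) := by gcongr
    _ = c * (w x * Real.exp (ℓ ϑ o x)) := by ring
    _ ≤ c * b x := by gcongr; exact h.weight_mul_exp_le hϑ o x

theorem weight_mul_exp_mul_norm_fderiv_le (h : DominatedLogDensity κ ν ℓ w b θ ε)
    (hϑ : ϑ ∈ Metric.ball θ ε) (o : O) (x : X) :
    w x * (Real.exp (ℓ ϑ o x) * ‖fderiv ℝ (fun ϑ => ℓ ϑ o x) ϑ‖) ≤ b x := by
  refine le_trans ?_ (h.weight_mul_le ϑ hϑ o x)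
  gcongr
  simp

theorem lintegral_weight_le (h : DominatedLogDensity κ ν ℓ w b θ ε) (hϑ : ϑ ∈ Metric.ball θ ε)
    (o : O) : ∫⁻ x, w x ∂κ ϑ o ≤ (∫ x, b x ∂ν).toNNReal := by
  have bound_nonneg (x : X) : 0 ≤ b x := le_trans (by positivity) (h.weight_mul_exp_le hϑ o x)
  have measurable_density : Measurable fun x => ENNReal.ofReal (Real.exp (ℓ ϑ o x)) :=
    (h.measurable_logDensity ϑ).of_uncurry_left.exp.ennreal_ofReal
  rw [h.apply, lintegral_withDensity_eq_lintegral_mul _ measurable_density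
    h.measurable_weight.coe_nnreal_ennreal]
  calc _ ≤ ∫⁻ x, ENNReal.ofReal (b x) ∂ν := lintegral_mono fun x => by
        rw [Pi.mul_apply, mul_comm, ← ENNReal.ofReal_coe_nnreal,
          ← ENNReal.ofReal_mul NNReal.zero_le_coe]
        exact ENNReal.ofReal_le_ofReal (h.weight_mul_exp_le hϑ o x)
    _ = (∫ x, b x ∂ν).toNNReal :=
        (ofReal_integral_eq_lintegral_ofReal h.integrable_bound (.of_forall bound_nonneg)).symm

theorem weight_mul_abs_exp_sub_le (h : DominatedLogDensity κ ν ℓ w b θ ε)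
    (hϑ : ϑ ∈ Metric.ball θ ε) (o : O) (x : X) :
    w x * |Real.exp (ℓ ϑ o x) - Real.exp (ℓ θ o x)| ≤ b x * ‖ϑ - θ‖ := by
  have hasFDerivAt_weight_mul_exp (ϑ : E) (hϑ : ϑ ∈ Metric.ball θ ε) :=
    (h.differentiableAt ϑ hϑ o x).hasFDerivAt.exp.const_mul (w x : ℝ)
  simpa [← mul_sub] using (convex_ball θ ε).norm_image_sub_le_of_norm_hasFDerivWithin_le
    (fun ϑ hϑ => (hasFDerivAt_weight_mul_exp ϑ hϑ).hasFDerivWithinAt)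
    (fun ϑ hϑ => by simpa [norm_smul] using h.weight_mul_exp_mul_norm_fderiv_le hϑ o x)
    (Metric.mem_ball_self h.pos) hϑ

theorem weightedTVDistLE (h : DominatedLogDensity κ ν ℓ w b θ ε) (hϑ : ϑ ∈ Metric.ball θ ε) :
    WeightedTVDistLE w (κ θ) (κ ϑ) ((∫ x, b x ∂ν).toNNReal * ‖ϑ - θ‖₊) := by
  intro f hf c hc o
  have measurable_logDensity (ϑ : E) : Measurable (ℓ ϑ o) :=
    (h.measurable_logDensity ϑ).of_uncurry_left
  have integrable_exp_smul {ϑ : E} (hϑ : ϑ ∈ Metric.ball θ ε) :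
      Integrable (fun x => Real.exp (ℓ ϑ o x) • f x) ν :=
    (h.integrable_bound.const_mul (c : ℝ)).mono'
      ((measurable_logDensity ϑ).exp.smul hf).aestronglyMeasurable
      (.of_forall fun x => h.norm_exp_smul_le hϑ o (hc x))
  rw [h.apply, h.apply, integral_withDensity_exp (measurable_logDensity ϑ),
    integral_withDensity_exp (measurable_logDensity θ), ← integral_sub (integrable_exp_smul hϑ)
      (integrable_exp_smul (Metric.mem_ball_self h.pos)), ← Real.norm_eq_abs]
  calc _ ≤ ∫ x, c * (b x * ‖ϑ - θ‖) ∂ν := by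
        refine norm_integral_le_of_norm_le
          ((h.integrable_bound.mul_const _).const_mul _) (.of_forall fun x => ?_)
        rw [← sub_smul, norm_smul, Real.norm_eq_abs, Real.norm_eq_abs]
        calc _ ≤ |Real.exp (ℓ ϑ o x) - Real.exp (ℓ θ o x)| * (c * w x) := by gcongr; exact hc x
          _ = c * (w x * |Real.exp (ℓ ϑ o x) - Real.exp (ℓ θ o x)|) := by ring
          _ ≤ c * (b x * ‖ϑ - θ‖) :=
              mul_le_mul_of_nonneg_left (h.weight_mul_abs_exp_sub_le hϑ o x) c.coe_nonneg
    _ = c * ((∫ x, b x ∂ν) * ‖ϑ - θ‖) := by rw [integral_const_mul, integral_mul_const]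
    _ ≤ _ := by
        push_cast
        gcongr
        exact Real.le_coe_toNNReal _

end NormedSpace

section InnerProductSpace

variable [InnerProductSpace ℝ E] [CompleteSpace E] {κ : E → Kernel O X} {ν : Measure X} [SFinite ν]
  {ℓ : E → O → X → ℝ} {w : X → ℝ≥0} {b : X → ℝ} {θ ϑ : E} {ε : ℝ} {g : O × X → ℝ} {c : ℝ≥0}

theorem norm_exp_smul_smul_gradient_le (h : DominatedLogDensity κ ν ℓ w b θ ε)
    (hgc : ∀ y, |g y| ≤ c * w y.2) (hϑ : ϑ ∈ Metric.ball θ ε) (y : O × X) :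
    ‖Real.exp (ℓ ϑ y.1 y.2) • g y • gradient (fun ϑ => ℓ ϑ y.1 y.2) ϑ‖ ≤ c * b y.2 := by
  have norm_gradient : ‖gradient (fun ϑ => ℓ ϑ y.1 y.2) ϑ‖ =
      ‖fderiv ℝ (fun ϑ => ℓ ϑ y.1 y.2) ϑ‖ := LinearIsometryEquiv.norm_map _ _
  rw [norm_smul, norm_smul, Real.norm_of_nonneg (Real.exp_nonneg _), Real.norm_eq_abs,
    norm_gradient]
  calc _ ≤ Real.exp (ℓ ϑ y.1 y.2) * (c * w y.2 * ‖fderiv ℝ (fun ϑ => ℓ ϑ y.1 y.2) ϑ‖) := by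
        gcongr
        exact hgc y
    _ = c * (w y.2 * (Real.exp (ℓ ϑ y.1 y.2) * ‖fderiv ℝ (fun ϑ => ℓ ϑ y.1 y.2) ϑ‖)) := by ring
    _ ≤ c * b y.2 := by
        gcongr
        exact h.weight_mul_exp_mul_norm_fderiv_le hϑ _ _

variable [TopologicalSpace.SeparableSpace E] (μ : Measure O)

theorem aestronglyMeasurable_exp_smul_smul_gradient (h : DominatedLogDensity κ ν ℓ w b θ ε)
    (hg : Measurable g) : AEStronglyMeasurable (fun y : O × X =>
      Real.exp (ℓ θ y.1 y.2) • g y • gradient (fun ϑ => ℓ ϑ y.1 y.2) θ) (μ.prod ν) :=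
  ((h.measurable_logDensity θ).exp.stronglyMeasurable.smul (hg.stronglyMeasurable.smul
    (stronglyMeasurable_gradient h.measurable_logDensity
      fun y => h.differentiableAt θ (Metric.mem_ball_self h.pos) y.1 y.2))).aestronglyMeasurable

variable [IsFiniteMeasure μ]

theorem integrable_exp_smul_smul_gradient (h : DominatedLogDensity κ ν ℓ w b θ ε)
    (hg : Measurable g) (hgc : ∀ y, |g y| ≤ c * w y.2) : Integrable (fun y : O × X =>
      Real.exp (ℓ θ y.1 y.2) • g y • gradient (fun ϑ => ℓ ϑ y.1 y.2) θ) (μ.prod ν) :=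
  ((h.integrable_bound.comp_snd μ).const_mul (c : ℝ)).mono'
    (h.aestronglyMeasurable_exp_smul_smul_gradient μ hg)
    (.of_forall (h.norm_exp_smul_smul_gradient_le hgc (Metric.mem_ball_self h.pos)))

theorem integrable_smul_gradient (h : DominatedLogDensity κ ν ℓ w b θ ε)
    (hg : Measurable g) (hgc : ∀ y, |g y| ≤ c * w y.2) :
    Integrable (fun y : O × X => g y • gradient (fun ϑ => ℓ ϑ y.1 y.2) θ) (μ ⊗ₘ κ θ) := by
  rw [h.compProd_eq, integrable_withDensity_exp_iff (h.measurable_logDensity θ)]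
  exact h.integrable_exp_smul_smul_gradient μ hg hgc

theorem hasGradientAt_integral_compProd (h : DominatedLogDensity κ ν ℓ w b θ ε)
    (hg : Measurable g) (hgc : ∀ y, |g y| ≤ c * w y.2) :
    HasGradientAt (fun ϑ => ∫ y, g y ∂(μ ⊗ₘ κ ϑ))
      (∫ y, g y • gradient (fun ϑ => ℓ ϑ y.1 y.2) θ ∂(μ ⊗ₘ κ θ)) θ := by
  simp only [h.compProd_eq, integral_withDensity_exp (h.measurable_logDensity _)]
  have measurable_exp_smul (ϑ : E) :
      AEStronglyMeasurable (fun y => Real.exp (ℓ ϑ y.1 y.2) • g y) (μ.prod ν) :=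
    ((h.measurable_logDensity ϑ).exp.smul hg).aestronglyMeasurable
  have integrable_bound : Integrable (fun y : O × X => c * b y.2) (μ.prod ν) :=
    (h.integrable_bound.comp_snd μ).const_mul (c : ℝ)
  have toDual_integral := (InnerProductSpace.toDual ℝ E).toContinuousLinearEquiv.integral_comp_comm
    (μ := μ.prod ν) fun y : O × X =>
      Real.exp (ℓ θ y.1 y.2) • g y • gradient (fun ϑ => ℓ ϑ y.1 y.2) θ
  rw [hasGradientAt_iff_hasFDerivAt]
  refine (hasFDerivAt_integral_of_dominated_of_fderiv_le (s := Metric.ball θ ε)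
    (F' := fun ϑ y => InnerProductSpace.toDual ℝ E
      (Real.exp (ℓ ϑ y.1 y.2) • g y • gradient (fun ϑ => ℓ ϑ y.1 y.2) ϑ))
    (bound := fun y => c * b y.2) (Metric.ball_mem_nhds θ h.pos)
    (.of_forall measurable_exp_smul) ?_ ?_ ?_ integrable_bound ?_).congr_fderiv toDual_integral
  · exact integrable_bound.mono' (measurable_exp_smul θ)
      (.of_forall fun y => h.norm_exp_smul_le (Metric.mem_ball_self h.pos) _ (hgc y))
  · exact (LinearIsometryEquiv.continuous _).comp_aestronglyMeasurable
      (h.aestronglyMeasurable_exp_smul_smul_gradient μ hg)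
  · refine .of_forall fun y ϑ hϑ => ?_
    rw [LinearIsometryEquiv.norm_map]
    exact h.norm_exp_smul_smul_gradient_le hgc hϑ y
  · refine .of_forall fun y ϑ hϑ => ?_
    have hasFDerivAt_exp :=
      (h.differentiableAt ϑ hϑ y.1 y.2).hasGradientAt.hasFDerivAt.exp.mul_const (g y)
    refine hasFDerivAt_exp.congr_fderiv ?_
    rw [map_smul, map_smul, smul_comm]

end InnerProductSpace

end DominatedLogDensity

/-! ### Policy gradients from dominated log-densities -/

namespace MDP

variable {O A : Type*} [MeasurableSpace O] [MeasurableSpace A] {M : MDP O A}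

theorem DominatedBy.lintegral_absReturn_rollouts_lt_top {π : Kernel O A} [IsMarkovKernel π]
    {w : A → ℝ≥0} {B : ℝ≥0} (h : M.DominatedBy π w B) :
    ∫⁻ ω, M.absReturn ω ∂M.rollout π < ∞ ∧
      (∀ o, ∫⁻ ω, M.absReturn ω ∂M.rolloutFromObs π o < ∞) ∧
      ∀ o a, ∫⁻ ω, M.absReturn ω ∂M.rolloutFromPair π (o, a) < ∞ := by
  refine ⟨?_, fun o => ?_, fun o a => ?_⟩
  · rw [rollout_eq]
    exact h.lintegral_absReturn_lt_top (h.lintegral_weight_compProd_lt_top M.init)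
  · rw [rolloutFromObs_apply]
    exact h.lintegral_absReturn_lt_top
      ((h.lintegral_weight_map_mk_le o).trans_lt ENNReal.coe_lt_top)
  · rw [← rolloutFrom_dirac]
    exact h.lintegral_absReturn_lt_top
      ((h.lintegral_weight_dirac (o, a)).trans_lt ENNReal.coe_lt_top)

variable {X E : Type*} [MeasurableSpace X] [NormedAddCommGroup E] {κ : E → Kernel O X}
  {ν : Measure X} [SFinite ν] {ℓ : E → O → X → ℝ} {f : X → A} {w : A → ℝ≥0} {b : X → ℝ} {θ : E}
  {ε : ℝ}

theorem dominatedBy_map [NormedSpace ℝ E]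
    (h : DominatedLogDensity κ ν ℓ (fun x => w (f x)) b θ ε) (hw : Measurable w)
    (hr : ∀ o a, ‖M.reward o a‖₊ ≤ w a) (hf : Measurable f) {ϑ : E} (hϑ : ϑ ∈ Metric.ball θ ε) :
    M.DominatedBy ((κ ϑ).map f) w (∫ x, b x ∂ν).toNNReal where
  measurable_weight := hw
  nnnorm_reward_le := hr
  lintegral_weight_le o := by
    rw [Kernel.map_apply _ hf, lintegral_map hw.coe_nnreal_ennreal hf]
    exact h.lintegral_weight_le hϑ o

variable [InnerProductSpace ℝ E] [CompleteSpace E] [TopologicalSpace.SeparableSpace E]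
  {π : E → Kernel O A} [∀ ϑ, IsMarkovKernel (π ϑ)]

theorem policyGradient (h : DominatedLogDensity κ ν ℓ (fun x => w (f x)) b θ ε)
    (hπ : ∀ ϑ, π ϑ = (κ ϑ).map f) (hf : Measurable f) (hw : Measurable w) (hw₁ : ∀ a, 1 ≤ w a)
    (hr : ∀ o a, ‖M.reward o a‖₊ ≤ w a) :
    (∀ᶠ ϑ in nhds θ, M.DominatedBy (π ϑ) w (∫ x, b x ∂ν).toNNReal) ∧
    Integrable (fun y : O × X =>
      M.advantage (π θ) y.1 (f y.2) • gradient (fun ϑ => ℓ ϑ y.1 y.2) θ)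
      (M.visitation (π θ) ⊗ₘ κ θ) ∧
    HasGradientAt (fun ϑ => M.J (π ϑ))
      (∫ y : O × X, M.advantage (π θ) y.1 (f y.2) • gradient (fun ϑ => ℓ ϑ y.1 y.2) θ
        ∂(M.visitation (π θ) ⊗ₘ κ θ)) θ := by
  set B := (∫ x, b x ∂ν).toNNReal
  have dominatedBy {ϑ : E} (hϑ : ϑ ∈ Metric.ball θ ε) :
      M.DominatedBy (π ϑ) w B := by
    rw [hπ]
    exact dominatedBy_map h hw hr hf hϑ
  have ball_mem_nhds := Metric.ball_mem_nhds θ h.pos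
  have measurable_advantage : Measurable fun y : O × X => M.advantage (π θ) y.1 (f y.2) :=
    ((M.stronglyMeasurable_advantage (π θ)).comp_measurable
      (measurable_fst.prodMk (hf.comp measurable_snd))).measurable
  have abs_advantage_le (y : O × X) : |M.advantage (π θ) y.1 (f y.2)| ≤
      (1 + (B + 2 * (B * M.horizon)) : ℝ≥0) * w (f y.2) :=
    (dominatedBy (Metric.mem_ball_self h.pos)).abs_advantage_le_mul hw₁ y.1 (f y.2)
  have integral_map_compProd (ϑ : E) :
      ∫ x, M.advantage (π θ) x.1 x.2 ∂(M.visitation (π θ) ⊗ₘ π ϑ) =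
        ∫ y, M.advantage (π θ) y.1 (f y.2) ∂(M.visitation (π θ) ⊗ₘ κ ϑ) := by
    have := h.isSFiniteKernel ϑ
    rw [hπ ϑ, Measure.compProd_map hf, integral_map (by fun_prop)
      (M.stronglyMeasurable_advantage (π θ)).aestronglyMeasurable]
    rfl
  refine ⟨Filter.eventually_of_mem ball_mem_nhds fun ϑ => dominatedBy,
    h.integrable_smul_gradient _ measurable_advantage abs_advantage_le, ?_⟩
  rw [hasGradientAt_iff_hasFDerivAt]
  refine hasFDerivAt_J (L := B) hw₁
    (Filter.eventually_of_mem ball_mem_nhds fun ϑ => dominatedBy)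
    (Filter.eventually_of_mem ball_mem_nhds fun ϑ hϑ => ?_) ?_
  · simp only [hπ]
    exact (h.weightedTVDistLE hϑ).map hf
  · simp only [integral_map_compProd]
    exact (h.hasGradientAt_integral_compProd _ measurable_advantage abs_advantage_le).hasFDerivAt

end MDP

/-! ### Isotropic Gaussian densities -/

theorem one_add_norm_le_mul {F : Type*} [SeminormedAddCommGroup F] (μ x : F) :
    1 + ‖x‖ ≤ (1 + ‖x - μ‖) * (1 + ‖μ‖) := by
  have norm_le := norm_add_le (x - μ) μ
  rw [sub_add_cancel] at norm_le
  nlinarith [norm_nonneg (x - μ), norm_nonneg μ]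

section IsotropicGaussian

variable {F : Type*} [NormedAddCommGroup F] [InnerProductSpace ℝ F] {σ : ℝ}

/-- The density of the Gaussian law `N(μ, σ² I)` on a finite-dimensional inner product space. -/
noncomputable def isotropicGaussianPDF (σ : ℝ) (μ x : F) : ℝ :=
  (2 * Real.pi * σ ^ 2) ^ (-(Module.finrank ℝ F : ℝ) / 2) *
    Real.exp (-‖x - μ‖ ^ 2 / (2 * σ ^ 2))

theorem isotropicGaussianPDF_nonneg (σ : ℝ) (μ x : F) : 0 ≤ isotropicGaussianPDF σ μ x := by
  unfold isotropicGaussianPDF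
  positivity

theorem isotropicGaussianPDF_pos (hσ : σ ≠ 0) (μ x : F) : 0 < isotropicGaussianPDF σ μ x := by
  unfold isotropicGaussianPDF
  positivity

theorem isotropicGaussianPDF_add_right (σ : ℝ) (μ x : F) :
    isotropicGaussianPDF σ μ (x + μ) = isotropicGaussianPDF σ 0 x := by
  simp only [isotropicGaussianPDF, add_sub_cancel_right, sub_zero]

theorem hasFDerivAt_log_isotropicGaussianPDF {E : Type*} [NormedAddCommGroup E] [NormedSpace ℝ E]
    (hσ : σ ≠ 0) (x : F) {μ : E → F} {μ' : E →L[ℝ] F} {θ : E} (h : HasFDerivAt μ μ' θ) :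
    HasFDerivAt (fun ϑ => Real.log (isotropicGaussianPDF σ (μ ϑ) x))
      ((σ ^ 2)⁻¹ • (innerSL ℝ (x - μ θ)).comp μ') θ := by
  set c := (2 * Real.pi * σ ^ 2) ^ (-(Module.finrank ℝ F : ℝ) / 2)
  have log_pdf : (fun ϑ => Real.log (isotropicGaussianPDF σ (μ ϑ) x)) =
      fun ϑ => Real.log c + -(2 * σ ^ 2)⁻¹ * ‖x - μ ϑ‖ ^ 2 := by
    funext ϑ
    rw [isotropicGaussianPDF, Real.log_mul (by positivity) (Real.exp_ne_zero _), Real.log_exp]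
    ring
  rw [log_pdf]
  refine (((h.const_sub x).norm_sq.const_mul _).const_add _).congr_fderiv ?_
  ext v
  simp only [map_sub, ContinuousLinearMap.comp_neg, ContinuousLinearMap.sub_comp, neg_apply,
    smul_apply, sub_apply, ContinuousLinearMap.comp_apply, coe_innerSL_apply, nsmul_eq_mul,
    Nat.cast_ofNat, smul_eq_mul]
  field_simp

theorem exp_neg_sq_div_mul_pow_le (hσ : σ ≠ 0) (N : ℕ) {s : ℝ} (hs : 0 ≤ s) :
    Real.exp (-s ^ 2 / (2 * σ ^ 2)) * (1 + s) ^ N ≤ N.factorial * Real.exp (1 + σ ^ 2 / 2) := by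
  have pow_le_exp : (1 + s) ^ N ≤ N.factorial * Real.exp (1 + s) := by
    have := Real.pow_div_factorial_le_exp (1 + s) (by positivity) N
    rwa [div_le_iff₀' (by positivity)] at this
  have complete_square : -s ^ 2 / (2 * σ ^ 2) + (1 + s) =
      1 + σ ^ 2 / 2 - (s - σ ^ 2) ^ 2 / (2 * σ ^ 2) := by
    field_simp
    ring
  calc Real.exp (-s ^ 2 / (2 * σ ^ 2)) * (1 + s) ^ N
      ≤ Real.exp (-s ^ 2 / (2 * σ ^ 2)) * (N.factorial * Real.exp (1 + s)) := by gcongr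
    _ = N.factorial * Real.exp (-s ^ 2 / (2 * σ ^ 2) + (1 + s)) := by
        rw [Real.exp_add (-s ^ 2 / (2 * σ ^ 2))]
        ring
    _ ≤ N.factorial * Real.exp (1 + σ ^ 2 / 2) := by
        rw [complete_square]
        gcongr
        exact sub_le_self _ (by positivity)

theorem exists_isotropicGaussianPDF_le (F : Type*) [NormedAddCommGroup F] [InnerProductSpace ℝ F]
    (hσ : σ ≠ 0) (N : ℕ) :
    ∃ c : ℝ, 0 ≤ c ∧ ∀ μ x : F,
      isotropicGaussianPDF σ μ x ≤ c * (1 + ‖μ‖) ^ N * ((1 + ‖x‖) ^ N)⁻¹ := by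
  set c := (2 * Real.pi * σ ^ 2) ^ (-(Module.finrank ℝ F : ℝ) / 2)
  refine ⟨c * (N.factorial * Real.exp (1 + σ ^ 2 / 2)), by positivity, fun μ x => ?_⟩
  rw [← div_eq_mul_inv, le_div_iff₀ (by positivity)]
  calc isotropicGaussianPDF σ μ x * (1 + ‖x‖) ^ N
      ≤ isotropicGaussianPDF σ μ x * ((1 + ‖x - μ‖) * (1 + ‖μ‖)) ^ N := by
        gcongr
        · exact isotropicGaussianPDF_nonneg σ μ x
        · exact one_add_norm_le_mul μ x
    _ = c * (Real.exp (-‖x - μ‖ ^ 2 / (2 * σ ^ 2)) * (1 + ‖x - μ‖) ^ N) * (1 + ‖μ‖) ^ N := by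
        rw [isotropicGaussianPDF, mul_pow]
        ring
    _ ≤ c * (N.factorial * Real.exp (1 + σ ^ 2 / 2)) * (1 + ‖μ‖) ^ N := by
        gcongr ?_ * _
        exact mul_le_mul_of_nonneg_left (exp_neg_sq_div_mul_pow_le hσ N (norm_nonneg _))
          (by positivity)

variable [MeasurableSpace F] [BorelSpace F]

theorem measurable_isotropicGaussianPDF [SecondCountableTopology F] (σ : ℝ) :
    Measurable fun p : F × F => isotropicGaussianPDF σ p.1 p.2 := by
  unfold isotropicGaussianPDF
  fun_prop

variable [FiniteDimensional ℝ F]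

theorem integrable_isotropicGaussianPDF (hσ : σ ≠ 0) (μ : F) :
    Integrable (isotropicGaussianPDF σ μ) := by
  have integral_ne_zero : ∫ v : F, Real.exp (-(2 * σ ^ 2)⁻¹ * ‖v‖ ^ 2) ≠ 0 := by
    rw [GaussianFourier.integral_rexp_neg_mul_sq_norm (by positivity)]
    positivity
  have integrable_exp := (Integrable.of_integral_ne_zero integral_ne_zero).comp_sub_right μ
  simp only [neg_mul, ← neg_div, inv_mul_eq_div] at integrable_exp
  exact integrable_exp.const_mul _

theorem integral_isotropicGaussianPDF_zero_mul_cexp (hσ : σ ≠ 0) (t : F) :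
    ∫ v, (isotropicGaussianPDF σ 0 v : ℂ) * Complex.exp (⟪v, t⟫ * Complex.I) =
      Complex.exp (-(σ ^ 2 * ‖t‖ ^ 2 / 2)) := by
  have hσ' : (σ : ℂ) ≠ 0 := mod_cast hσ
  have re_pos : 0 < (((2 * σ ^ 2)⁻¹ : ℝ) : ℂ).re := by
    rw [Complex.ofReal_re]
    positivity
  have integrand_eq (v : F) :
      (isotropicGaussianPDF σ 0 v : ℂ) * Complex.exp (⟪v, t⟫ * Complex.I) =
        ((2 * Real.pi * σ ^ 2 : ℝ) : ℂ) ^ (-(Module.finrank ℝ F : ℂ) / 2) *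
          Complex.exp (-((2 * σ ^ 2)⁻¹ : ℝ) * ‖v‖ ^ 2 + Complex.I * ⟪t, v⟫) := by
    rw [isotropicGaussianPDF, sub_zero, real_inner_comm, Complex.exp_add, Complex.ofReal_mul,
      Complex.ofReal_cpow (by positivity)]
    push_cast
    ring_nf
  have pi_div : (Real.pi : ℂ) / ((2 * σ ^ 2)⁻¹ : ℝ) = ((2 * Real.pi * σ ^ 2 : ℝ) : ℂ) := by
    push_cast
    field_simp
  have normalization : ((2 * Real.pi * σ ^ 2 : ℝ) : ℂ) ^ (-(Module.finrank ℝ F : ℂ) / 2) *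
      ((2 * Real.pi * σ ^ 2 : ℝ) : ℂ) ^ ((Module.finrank ℝ F : ℂ) / 2) = 1 := by
    rw [← Complex.cpow_add _ _ (by exact_mod_cast (by positivity : 2 * Real.pi * σ ^ 2 ≠ 0)),
      neg_div, neg_add_cancel, Complex.cpow_zero]
  simp_rw [integrand_eq]
  rw [integral_const_mul, GaussianFourier.integral_cexp_neg_mul_sq_norm_add re_pos, pi_div,
    ← mul_assoc, normalization, one_mul, Complex.I_sq]
  congr 1
  push_cast
  field_simp
  ring

theorem charFun_withDensity_isotropicGaussianPDF (hσ : σ ≠ 0) (μ t : F) :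
    charFun (volume.withDensity fun x => ENNReal.ofReal (isotropicGaussianPDF σ μ x)) t =
      Complex.exp (⟪t, μ⟫ * Complex.I - σ ^ 2 * ‖t‖ ^ 2 / 2) := by
  have measurable_pdf : Measurable fun x => ENNReal.ofReal (isotropicGaussianPDF σ μ x) :=
    ((measurable_isotropicGaussianPDF σ).comp measurable_prodMk_left).ennreal_ofReal
  rw [charFun_apply, integral_withDensity_eq_integral_toReal_smul measurable_pdf
    (.of_forall fun _ => ENNReal.ofReal_lt_top), ← integral_add_right_eq_self _ μ]
  simp only [isotropicGaussianPDF_add_right, Complex.real_smul,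
    ENNReal.toReal_ofReal (isotropicGaussianPDF_nonneg σ (0 : F) _), inner_add_left,
    Complex.ofReal_add, add_mul, Complex.exp_add, ← mul_assoc]
  rw [integral_mul_const, integral_isotropicGaussianPDF_zero_mul_cexp hσ, ← Complex.exp_add,
    real_inner_comm]
  ring_nf

end IsotropicGaussian

theorem multivariateGaussian_eq_withDensity {ι : Type*} [Fintype ι] [DecidableEq ι] {σ : ℝ}
    (hσ : σ ≠ 0) (μ : EuclideanSpace ℝ ι) :
    multivariateGaussian μ (σ ^ 2 • (1 : Matrix ι ι ℝ)) =
      volume.withDensity fun x => ENNReal.ofReal (isotropicGaussianPDF σ μ x) := by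
  have := isFiniteMeasure_withDensity_ofReal (integrable_isotropicGaussianPDF hσ μ).2
  have posSemidef : (σ ^ 2 • (1 : Matrix ι ι ℝ)).PosSemidef :=
    Matrix.PosSemidef.one.smul (sq_nonneg σ)
  have quadraticForm (t : EuclideanSpace ℝ ι) :
      (t : ι → ℝ) ⬝ᵥ (σ ^ 2 • (1 : Matrix ι ι ℝ)).mulVec t = σ ^ 2 * ‖t‖ ^ 2 := by
    rw [Matrix.smul_mulVec, Matrix.one_mulVec, dotProduct_smul, EuclideanSpace.real_norm_sq_eq,
      smul_eq_mul, dotProduct]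
    simp_rw [sq]
  refine Measure.ext_of_charFun (funext fun t => ?_)
  rw [charFun_multivariateGaussian posSemidef, charFun_withDensity_isotropicGaussianPDF hσ,
    quadraticForm]
  push_cast
  rfl

/-! ### The denoising chain -/

theorem withDensity_map {X Y : Type*} [MeasurableSpace X] [MeasurableSpace Y] {μ : Measure X}
    {f : X → Y} (hf : Measurable f) {g : Y → ℝ≥0∞} (hg : Measurable g) :
    (μ.map f).withDensity g = (μ.withDensity (g ∘ f)).map f := by
  ext s hs
  rw [withDensity_apply _ hs, setLIntegral_map hs hg hf, Measure.map_apply hf hs,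
    withDensity_apply _ (hf hs)]
  rfl

theorem withDensity_compProd_withDensity_const {X Y : Type*} [MeasurableSpace X]
    [MeasurableSpace Y] (μ : Measure X) [SFinite μ] (ν : Measure Y) [SFinite ν] {f : X → ℝ≥0∞}
    (hf : Measurable f) {g : X → Y → ℝ≥0∞} (hg : Measurable (Function.uncurry g))
    [IsSFiniteKernel ((Kernel.const X ν).withDensity g)] :
    μ.withDensity f ⊗ₘ (Kernel.const X ν).withDensity g =
      (μ.prod ν).withDensity fun p => f p.1 * g p.1 p.2 := by
  rw [Measure.compProd_withDensity hg, Measure.compProd_const, prod_withDensity_left hf]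
  exact (withDensity_mul _ (hf.comp measurable_fst) hg).symm

namespace VelocityField

section Density

variable {d : ℕ} {O : Type*} [MeasurableSpace O] (u : VelocityField d O) {σ : ℝ} (K k n : ℕ)

theorem transitionDensity_eq_isotropicGaussianPDF (σ : ℝ) (o : O) (a a' : Act d) :
    u.transitionDensity σ K k o a a' = isotropicGaussianPDF σ (u.mean K k o a) a' := by
  rw [transitionDensity, isotropicGaussianPDF, finrank_euclideanSpace_fin]

theorem transitionDensity_pos (hσ : σ ≠ 0) (o : O) (a a' : Act d) :
    0 < u.transitionDensity σ K k o a a' := by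
  rw [transitionDensity_eq_isotropicGaussianPDF]
  exact isotropicGaussianPDF_pos hσ _ _

theorem measurable_transitionDensity (σ : ℝ) :
    Measurable fun p : (O × Act d) × Act d => u.transitionDensity σ K k p.1.1 p.1.2 p.2 := by
  simp only [transitionDensity_eq_isotropicGaussianPDF]
  exact (measurable_isotropicGaussianPDF σ).comp
    (f := fun p : (O × Act d) × Act d => (u.mean K k p.1.1 p.1.2, p.2))
    (((u.measurable_mean K k).comp measurable_fst).prodMk measurable_snd)

theorem measurable_transitionDensity_last (σ : ℝ) (o : O) :
    Measurable (Function.uncurry fun (x : Fin (n + 1) → Act d) a' =>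
      ENNReal.ofReal (u.transitionDensity σ K n o (x (Fin.last n)) a')) :=
  ((u.measurable_transitionDensity K n σ).comp (f := fun p : (Fin (n + 1) → Act d) × Act d =>
    ((o, p.1 (Fin.last n)), p.2)) (by fun_prop)).ennreal_ofReal

theorem transition_apply (hσ : σ ≠ 0) (o : O) (a : Act d) :
    u.transition σ K k (o, a) =
      volume.withDensity fun a' => ENNReal.ofReal (u.transitionDensity σ K k o a a') := by
  simp only [transitionDensity_eq_isotropicGaussianPDF]
  exact multivariateGaussian_eq_withDensity hσ _

/-- The reference measure `N(0, I) ⊗ vol ⊗ ⋯ ⊗ vol` for the first `n + 1` states of a denoising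
chain. -/
noncomputable def chainRefMeasure (d : ℕ) : (n : ℕ) → Measure (Fin (n + 1) → Act d)
  | 0 => (stdGaussian (Act d)).map fun a _ => a
  | n + 1 =>
    ((chainRefMeasure d n).prod volume).map fun p => Fin.snoc (α := fun _ => Act d) p.1 p.2

instance (d n : ℕ) : SFinite (chainRefMeasure d n) := by
  induction n with
  | zero => unfold chainRefMeasure; infer_instance
  | succ n ih => unfold chainRefMeasure; infer_instance

theorem measurePreserving_init_last (d n : ℕ) :
    MeasurePreserving (fun y : Fin (n + 2) → Act d => (Fin.init y, y (Fin.last (n + 1))))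
      (chainRefMeasure d (n + 1)) ((chainRefMeasure d n).prod volume) := by
  have measurable_init_last : Measurable fun y : Fin (n + 2) → Act d =>
      ((Fin.init y : Fin (n + 1) → Act d), y (Fin.last (n + 1))) := by
    unfold Fin.init
    fun_prop
  refine ⟨measurable_init_last, ?_⟩
  rw [chainRefMeasure, Measure.map_map measurable_init_last (measurable_snoc (n + 1))]
  simp [Function.comp_def]

/-- The log-density of the law of the first `n + 1` states of the `K`-step denoising chain with
respect to `chainRefMeasure`. The Gaussian density of the initial state is part of the reference
measure, as it does not depend on the velocity field. -/
noncomputable def logChainDensity (σ : ℝ) (K n : ℕ) (o : O) (x : Fin (n + 1) → Act d) : ℝ :=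
  ∑ k : Fin n, Real.log (u.transitionDensity σ K k o (x k.castSucc) (x k.succ))

theorem logChainDensity_succ (σ : ℝ) (o : O) (x : Fin (n + 2) → Act d) :
    u.logChainDensity σ K (n + 1) o x = u.logChainDensity σ K n o (Fin.init x) +
      Real.log (u.transitionDensity σ K n o (Fin.init x (Fin.last n)) (x (Fin.last (n + 1)))) :=
  Fin.sum_univ_castSucc _

theorem exp_logChainDensity_succ (hσ : σ ≠ 0) (o : O) (x : Fin (n + 2) → Act d) :
    Real.exp (u.logChainDensity σ K (n + 1) o x) =
      Real.exp (u.logChainDensity σ K n o (Fin.init x)) *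
        u.transitionDensity σ K n o (Fin.init x (Fin.last n)) (x (Fin.last (n + 1))) := by
  rw [logChainDensity_succ, Real.exp_add, Real.exp_log (u.transitionDensity_pos _ _ hσ _ _ _)]

theorem measurable_logChainDensity (σ : ℝ) :
    Measurable (Function.uncurry (u.logChainDensity σ K n)) := by
  have measurable_density (k : Fin n) : Measurable fun p : O × (Fin (n + 1) → Act d) =>
      u.transitionDensity σ K k p.1 (p.2 k.castSucc) (p.2 k.succ) :=
    (u.measurable_transitionDensity K k σ).comp (f := fun p : O × (Fin (n + 1) → Act d) =>
      ((p.1, p.2 k.castSucc), p.2 k.succ)) (by fun_prop)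
  simp only [Function.uncurry_def, logChainDensity]
  exact Finset.measurable_fun_sum _ fun k _ => (measurable_density k).log

theorem chain_succ_apply (hσ : σ ≠ 0) (o : O) :
    u.chain σ K (n + 1) o = (u.chain σ K n o ⊗ₘ (Kernel.const _ volume).withDensity fun x a' =>
      ENNReal.ofReal (u.transitionDensity σ K n o (x (Fin.last n)) a')).map
        fun p => Fin.snoc (α := fun _ => Act d) p.1 p.2 := by
  rw [chain, Kernel.map_apply _ (measurable_snoc (n + 1)),
    Kernel.compProd_apply_eq_compProd_sectR]
  congr 2
  ext1 x
  rw [Kernel.withDensity_apply _ (u.measurable_transitionDensity_last K n σ o), Kernel.const_apply,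
    ← u.transition_apply _ _ hσ]
  rfl

theorem chain_apply (hσ : σ ≠ 0) (o : O) :
    u.chain σ K n o = (chainRefMeasure d n).withDensity fun x =>
      ENNReal.ofReal (Real.exp (u.logChainDensity σ K n o x)) := by
  induction n with
  | zero => simp [chain, chainRefMeasure, logChainDensity]
  | succ n ih =>
    have measurable_density (n : ℕ) : Measurable fun x =>
        ENNReal.ofReal (Real.exp (u.logChainDensity σ K n o x)) :=
      (u.measurable_logChainDensity K n σ).of_uncurry_left.exp.ennreal_ofReal
    have := Kernel.IsSFiniteKernel.withDensity (Kernel.const (Fin (n + 1) → Act d) volume)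
      fun x a' => ENNReal.ofReal_ne_top (r := u.transitionDensity σ K n o (x (Fin.last n)) a')
    rw [chain_succ_apply _ _ _ hσ, ih, withDensity_compProd_withDensity_const _ _
      (measurable_density n) (u.measurable_transitionDensity_last K n σ o), chainRefMeasure,
      withDensity_map (measurable_snoc (n + 1)) (measurable_density (n + 1))]
    congr 2
    funext p
    simp [exp_logChainDensity_succ _ _ _ hσ, ENNReal.ofReal_mul (Real.exp_nonneg _)]

theorem chain_eq_withDensity (hσ : σ ≠ 0) :
    u.chain σ K n = (Kernel.const O (chainRefMeasure d n)).withDensity fun o x =>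
      ENNReal.ofReal (Real.exp (u.logChainDensity σ K n o x)) := by
  ext1 o
  rw [Kernel.withDensity_apply _ (u.measurable_logChainDensity K n σ).exp.ennreal_ofReal,
    Kernel.const_apply, u.chain_apply K n hσ]

end Density

end VelocityField

/-- The product `∏ (1 + ‖x i‖)`, whose powers measure the polynomial growth of functions of a
denoising chain `x`. -/
noncomputable def chainWeight {ι F : Type*} [Fintype ι] [SeminormedAddCommGroup F] (x : ι → F) :
    ℝ :=
  ∏ i, (1 + ‖x i‖)

section ChainWeight

variable {ι F : Type*} [SeminormedAddCommGroup F]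

theorem one_le_chainWeight [Fintype ι] (x : ι → F) : 1 ≤ chainWeight x :=
  Finset.one_le_prod fun i _ => le_add_of_nonneg_right (norm_nonneg (x i))

theorem one_add_norm_le_chainWeight [Fintype ι] (x : ι → F) (i : ι) :
    1 + ‖x i‖ ≤ chainWeight x :=
  (Finset.prod_singleton (fun i => 1 + ‖x i‖) i).symm.trans_le <|
    Finset.prod_le_prod_of_subset_of_one_le (Finset.subset_univ {i}) (fun j _ => by positivity)
      fun j _ _ => le_add_of_nonneg_right (norm_nonneg (x j))

theorem chainWeight_succ {n : ℕ} (x : Fin (n + 1) → F) :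
    chainWeight x = chainWeight (Fin.init x : Fin n → F) * (1 + ‖x (Fin.last n)‖) :=
  Fin.prod_univ_castSucc _

end ChainWeight

theorem integrable_inv_one_add_norm_pow {F : Type*} [NormedAddCommGroup F] [NormedSpace ℝ F]
    [FiniteDimensional ℝ F] [MeasurableSpace F] [BorelSpace F] (μ : Measure F)
    [μ.IsAddHaarMeasure] {n : ℕ} (hn : Module.finrank ℝ F < n) :
    Integrable (fun x => ((1 + ‖x‖) ^ n)⁻¹) μ := by
  have integrable_rpow := integrable_one_add_norm (μ := μ) (r := n) (mod_cast hn)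
  refine integrable_rpow.congr (.of_forall fun x => ?_)
  simp only [Real.rpow_neg (by positivity : 0 ≤ 1 + ‖x‖), Real.rpow_natCast]

theorem integrable_one_add_norm_pow {F : Type*} [NormedAddCommGroup F] [NormedSpace ℝ F]
    [CompleteSpace F] [SecondCountableTopology F] [MeasurableSpace F] [BorelSpace F]
    (μ : Measure F) [IsGaussian μ] (j : ℕ) : Integrable (fun x => (1 + ‖x‖) ^ j) μ := by
  have memLp_id : MemLp (fun x : F => x) j μ := IsGaussian.memLp_id μ j (ENNReal.natCast_ne_top j)
  have memLp : MemLp (fun x : F => 1 + ‖x‖) j μ := (memLp_const (1 : ℝ)).add memLp_id.norm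
  refine memLp.integrable_norm_pow'.congr (.of_forall fun x => ?_)
  simp only [Real.norm_of_nonneg (by positivity : 0 ≤ 1 + ‖x‖)]

theorem abs_flowTime_sub_le (K k : ℕ) : |flowTime K k - flowTime K (k + 1)| ≤ 1 := by
  have flowTime_sub : flowTime K k - flowTime K (k + 1) = (K : ℝ)⁻¹ := by
    simp only [flowTime]
    push_cast
    ring
  rw [flowTime_sub, abs_of_nonneg (by positivity)]
  exact Nat.cast_inv_le_one K

namespace VelocityField

variable {d : ℕ} {O : Type*} [MeasurableSpace O] {σ : ℝ} {K k n : ℕ} {C : ℝ≥0} {m : ℕ}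

/-- The velocity field `u` is bounded by `C (1 + ‖a‖) ^ m` at the flow times of the `K`-step
chain. -/
def PolynomialGrowth (u : VelocityField d O) (K : ℕ) (C : ℝ≥0) (m : ℕ) : Prop :=
  ∀ k < K, ∀ (a : Act d) (o : O),
    ‖u.toFun a (flowTime K (k + 1)) (flowTime K k) o‖ ≤ C * (1 + ‖a‖) ^ m

theorem PolynomialGrowth.one_add_norm_mean_le {u : VelocityField d O}
    (h : u.PolynomialGrowth K C m) (hk : k < K) (o : O) (a : Act d) :
    1 + ‖u.mean K k o a‖ ≤ (1 + C) * (1 + ‖a‖) ^ (m + 1) := by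
  have norm_velocity_le : ‖(flowTime K k - flowTime K (k + 1)) •
      u.toFun a (flowTime K (k + 1)) (flowTime K k) o‖ ≤ C * (1 + ‖a‖) ^ m := by
    rw [norm_smul, Real.norm_eq_abs]
    exact (mul_le_of_le_one_left (norm_nonneg _) (abs_flowTime_sub_le K k)).trans (h k hk a o)
  have one_le : 1 ≤ 1 + ‖a‖ := le_add_of_nonneg_right (norm_nonneg a)
  calc 1 + ‖u.mean K k o a‖ ≤ 1 + (‖a‖ + C * (1 + ‖a‖) ^ m) := by
        gcongr
        exact (norm_sub_le _ _).trans (by gcongr)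
    _ = (1 + ‖a‖) + C * (1 + ‖a‖) ^ m := by ring
    _ ≤ (1 + ‖a‖) ^ (m + 1) + C * (1 + ‖a‖) ^ (m + 1) := by
        gcongr
        · exact le_self_pow₀ one_le (Nat.succ_ne_zero m)
        · exact Nat.le_succ m
    _ = (1 + C) * (1 + ‖a‖) ^ (m + 1) := by ring

theorem exists_pow_mul_transitionDensity_le (d : ℕ) (O : Type*) [MeasurableSpace O] (hσ : σ ≠ 0)
    (K : ℕ) (C : ℝ≥0) (m j : ℕ) :
    ∃ (c : ℝ) (N : ℕ), 0 ≤ c ∧ ∀ u : VelocityField d O, u.PolynomialGrowth K C m →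
      ∀ k < K, ∀ o a a', (1 + ‖a'‖) ^ j * u.transitionDensity σ K k o a a' ≤
        c * (1 + ‖a‖) ^ N * ((1 + ‖a'‖) ^ (d + 1))⁻¹ := by
  obtain ⟨c, c_nonneg, pdf_le⟩ := exists_isotropicGaussianPDF_le (Act d) hσ (j + (d + 1))
  refine ⟨c * (1 + C) ^ (j + (d + 1)), (m + 1) * (j + (d + 1)), by positivity,
    fun u hu k hk o a a' => ?_⟩
  rw [u.transitionDensity_eq_isotropicGaussianPDF]
  calc _ ≤ (1 + ‖a'‖) ^ j * (c * ((1 + C) * (1 + ‖a‖) ^ (m + 1)) ^ (j + (d + 1)) *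
          ((1 + ‖a'‖) ^ (j + (d + 1)))⁻¹) := by
        gcongr
        refine (pdf_le _ _).trans ?_
        gcongr
        exact hu.one_add_norm_mean_le hk o a
    _ = _ := by
        rw [mul_pow, ← pow_mul, pow_add (1 + ‖a'‖)]
        field_simp

theorem integrable_chainWeight_pow (d j : ℕ) :
    Integrable (fun x => chainWeight x ^ j) (chainRefMeasure d 0) := by
  have measurable_const_fun : Measurable fun (a : Act d) (_ : Fin (0 + 1)) => a := by fun_prop
  have continuous_weight : Continuous fun x : Fin (0 + 1) → Act d => chainWeight x ^ j := by
    unfold chainWeight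
    fun_prop
  refine (integrable_map_measure continuous_weight.aestronglyMeasurable
    measurable_const_fun.aemeasurable).2 ?_
  simpa [Function.comp_def, chainWeight] using integrable_one_add_norm_pow (stdGaussian (Act d)) j

theorem exists_chainWeight_pow_mul_exp_logChainDensity_le (d : ℕ) (O : Type*) [MeasurableSpace O]
    (hσ : σ ≠ 0) (C : ℝ≥0) (m : ℕ) (hn : n ≤ K) (j : ℕ) :
    ∃ b : (Fin (n + 1) → Act d) → ℝ, Integrable b (chainRefMeasure d n) ∧
      ∀ u : VelocityField d O, u.PolynomialGrowth K C m → ∀ o x,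
        chainWeight x ^ j * Real.exp (u.logChainDensity σ K n o x) ≤ b x := by
  induction n generalizing j with
  | zero =>
    exact ⟨_, integrable_chainWeight_pow d j, fun u _ o x => by simp [logChainDensity]⟩
  | succ n ih =>
    obtain ⟨c, N, c_nonneg, transitionDensity_le⟩ :=
      exists_pow_mul_transitionDensity_le d O hσ K C m j
    obtain ⟨b, integrable_b, le_b⟩ := ih (by lia) (j + N)
    have integrable_inv : Integrable fun a : Act d => ((1 + ‖a‖) ^ (d + 1))⁻¹ :=
      integrable_inv_one_add_norm_pow volume (by simp)
    refine ⟨fun x => c * b (Fin.init x) * ((1 + ‖x (Fin.last (n + 1))‖) ^ (d + 1))⁻¹,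
      (measurePreserving_init_last d n).integrable_comp_of_integrable
        ((integrable_b.const_mul c).mul_prod integrable_inv), fun u hu o x => ?_⟩
    rw [chainWeight_succ, mul_pow, u.exp_logChainDensity_succ _ _ hσ]
    set y : Fin (n + 1) → Act d := Fin.init x
    have weight_nonneg : 0 ≤ chainWeight y := zero_le_one.trans (one_le_chainWeight y)
    calc _ = chainWeight y ^ j * Real.exp (u.logChainDensity σ K n o y) *
          ((1 + ‖x (Fin.last (n + 1))‖) ^ j *
            u.transitionDensity σ K n o (y (Fin.last n)) (x (Fin.last (n + 1)))) := by ring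
      _ ≤ chainWeight y ^ j * Real.exp (u.logChainDensity σ K n o y) *
          (c * chainWeight y ^ N * ((1 + ‖x (Fin.last (n + 1))‖) ^ (d + 1))⁻¹) := by
          refine mul_le_mul_of_nonneg_left ?_ (by positivity)
          refine (transitionDensity_le u hu n (by lia) o _ _).trans ?_
          gcongr
          exact one_add_norm_le_chainWeight y (Fin.last n)
      _ = c * (chainWeight y ^ (j + N) * Real.exp (u.logChainDensity σ K n o y)) *
          ((1 + ‖x (Fin.last (n + 1))‖) ^ (d + 1))⁻¹ := by ring
      _ ≤ c * b y * ((1 + ‖x (Fin.last (n + 1))‖) ^ (d + 1))⁻¹ := by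
          gcongr
          exact le_b u hu o y

section Parameter

variable {E : Type*} [NormedAddCommGroup E] [NormedSpace ℝ E]

/-- At the parameter `θ`, the velocity field has polynomial growth and is differentiable in the
parameter with a derivative of the same growth, at the flow times of the `K`-step chain. -/
structure SmoothPolynomialGrowthAt (u : E → VelocityField d O) (K : ℕ) (C : ℝ≥0) (m : ℕ)
    (θ : E) : Prop where
  polynomialGrowth : (u θ).PolynomialGrowth K C m
  differentiableAt : ∀ k < K, ∀ (a : Act d) (o : O), DifferentiableAt ℝ
    (fun ϑ => (u ϑ).toFun a (flowTime K (k + 1)) (flowTime K k) o) θ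
  norm_fderiv_le : ∀ k < K, ∀ (a : Act d) (o : O),
    ‖fderiv ℝ (fun ϑ => (u ϑ).toFun a (flowTime K (k + 1)) (flowTime K k) o) θ‖ ≤
      C * (1 + ‖a‖) ^ m

variable {u : E → VelocityField d O} {θ : E}

namespace SmoothPolynomialGrowthAt

theorem exists_hasFDerivAt_mean (h : SmoothPolynomialGrowthAt u K C m θ) (hk : k < K) (o : O)
    (a : Act d) : ∃ μ' : E →L[ℝ] Act d,
      HasFDerivAt (fun ϑ => (u ϑ).mean K k o a) μ' θ ∧ ‖μ'‖ ≤ C * (1 + ‖a‖) ^ m := by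
  refine ⟨_, ((h.differentiableAt k hk a o).hasFDerivAt.const_smul
    (flowTime K k - flowTime K (k + 1))).const_sub a, ?_⟩
  rw [norm_neg, norm_smul, Real.norm_eq_abs]
  exact (mul_le_of_le_one_left (norm_nonneg _) (abs_flowTime_sub_le K k)).trans
    (h.norm_fderiv_le k hk a o)

theorem exists_hasFDerivAt_log_transitionDensity (h : SmoothPolynomialGrowthAt u K C m θ)
    (hσ : σ ≠ 0) (hk : k < K) (o : O) (a a' : Act d) : ∃ f' : E →L[ℝ] ℝ,
      HasFDerivAt (fun ϑ => Real.log ((u ϑ).transitionDensity σ K k o a a')) f' θ ∧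
      ‖f'‖ ≤ (σ ^ 2)⁻¹ * (1 + C) * C * ((1 + ‖a'‖) * (1 + ‖a‖) ^ (2 * m + 1)) := by
  obtain ⟨μ', hasFDerivAt_mean, norm_le⟩ := h.exists_hasFDerivAt_mean hk o a
  simp only [transitionDensity_eq_isotropicGaussianPDF]
  refine ⟨_, hasFDerivAt_log_isotropicGaussianPDF hσ a' hasFDerivAt_mean, ?_⟩
  have norm_sub_mean_le : ‖a' - (u θ).mean K k o a‖ ≤
      (1 + ‖a'‖) * ((1 + C) * (1 + ‖a‖) ^ (m + 1)) :=
    calc _ ≤ ‖a'‖ + ‖(u θ).mean K k o a‖ := norm_sub_le _ _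
      _ ≤ (1 + ‖a'‖) * (1 + ‖(u θ).mean K k o a‖) := by
          nlinarith [norm_nonneg a', norm_nonneg ((u θ).mean K k o a)]
      _ ≤ _ := by
          gcongr
          exact h.polynomialGrowth.one_add_norm_mean_le hk o a
  calc _ ≤ (σ ^ 2)⁻¹ * (‖a' - (u θ).mean K k o a‖ * ‖μ'‖) := by
        rw [norm_smul, Real.norm_of_nonneg (by positivity)]
        gcongr
        simpa only [innerSL_apply_norm] using ContinuousLinearMap.opNorm_comp_le (innerSL ℝ _) μ'
    _ ≤ (σ ^ 2)⁻¹ * ((1 + ‖a'‖) * ((1 + C) * (1 + ‖a‖) ^ (m + 1)) * (C * (1 + ‖a‖) ^ m)) := by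
        gcongr
    _ = _ := by ring

theorem exists_hasFDerivAt_logChainDensity (h : SmoothPolynomialGrowthAt u K C m θ) (hσ : σ ≠ 0)
    (hn : n ≤ K) (o : O) (x : Fin (n + 1) → Act d) : ∃ f' : E →L[ℝ] ℝ,
      HasFDerivAt (fun ϑ => (u ϑ).logChainDensity σ K n o x) f' θ ∧
      ‖f'‖ ≤ n * ((σ ^ 2)⁻¹ * (1 + C) * C) * chainWeight x ^ (2 * m + 2) := by
  choose f' hasFDerivAt_log norm_le using fun k : Fin n =>
    h.exists_hasFDerivAt_log_transitionDensity hσ (k.2.trans_le hn) o (x k.castSucc) (x k.succ)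
  refine ⟨_, .fun_sum fun k _ => hasFDerivAt_log k, ?_⟩
  calc _ ≤ ∑ _ : Fin n, (σ ^ 2)⁻¹ * (1 + C) * C *
          (chainWeight x * chainWeight x ^ (2 * m + 1)) := by
        refine norm_sum_le_of_le _ fun k _ => (norm_le k).trans ?_
        have := one_le_chainWeight x
        gcongr <;> exact one_add_norm_le_chainWeight x _
    _ = _ := by
        rw [Finset.sum_const, Finset.card_univ, Fintype.card_fin, nsmul_eq_mul]
        ring

end SmoothPolynomialGrowthAt

theorem exists_dominatedLogDensity_chain (hσ : σ ≠ 0) {ε : ℝ} (hε : 0 < ε)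
    (h : ∀ ϑ ∈ Metric.ball θ ε, SmoothPolynomialGrowthAt u K C m ϑ) (c : ℝ≥0) (j : ℕ) :
    ∃ b, DominatedLogDensity (fun ϑ => (u ϑ).chain σ K K) (chainRefMeasure d K)
      (fun ϑ => (u ϑ).logChainDensity σ K K) (fun x => c * (1 + ‖x (Fin.last K)‖₊) ^ j) b θ ε := by
  obtain ⟨b, integrable_b, le_b⟩ := exists_chainWeight_pow_mul_exp_logChainDensity_le d O hσ C m
    (le_refl K) (j + (2 * m + 2))
  set S : ℝ := K * ((σ ^ 2)⁻¹ * (1 + C) * C)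
  refine ⟨fun x => c * (1 + S) * b x, hε, fun ϑ => (u ϑ).measurable_logChainDensity K K σ,
    fun ϑ => (u ϑ).chain_eq_withDensity K K hσ, by fun_prop, integrable_b.const_mul _,
    fun ϑ hϑ o x => ?_, fun ϑ hϑ o x => ?_⟩ <;>
  obtain ⟨f', hasFDerivAt_log, norm_le⟩ :=
    (h ϑ hϑ).exists_hasFDerivAt_logChainDensity hσ (le_refl K) o x
  · exact hasFDerivAt_log.differentiableAt
  · rw [hasFDerivAt_log.fderiv]
    have one_le_weight := one_le_chainWeight x
    push_cast
    calc _ ≤ c * chainWeight x ^ j * (Real.exp ((u ϑ).logChainDensity σ K K o x) *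
          (chainWeight x ^ (2 * m + 2) + S * chainWeight x ^ (2 * m + 2))) := by
          gcongr
          · exact one_add_norm_le_chainWeight x _
          · exact one_le_pow₀ one_le_weight
      _ = c * (1 + S) * (chainWeight x ^ (j + (2 * m + 2)) *
          Real.exp ((u ϑ).logChainDensity σ K K o x)) := by ring
      _ ≤ c * (1 + S) * b x := by
          gcongr
          exact le_b _ (h ϑ hϑ).polynomialGrowth o x

end Parameter

end VelocityField

theorem mainTheorem1_general {d K : ℕ} {σ : ℝ} (hσ : σ ≠ 0) {O : Type*} [MeasurableSpace O]
    {E : Type*} [NormedAddCommGroup E] [InnerProductSpace ℝ E] [CompleteSpace E]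
    [TopologicalSpace.SeparableSpace E]
    (M : MDP O (Act d)) (u : E → VelocityField d O) (θ : E)
    (hr : ∃ (C : ℝ) (m : ℕ), ∀ (o : O) (a : Act d), |M.reward o a| ≤ C * (1 + ‖a‖) ^ m)
    (hu : ∃ ε > 0, ∃ (C : ℝ) (m : ℕ), ∀ θ' ∈ Metric.ball θ ε, ∀ k < K, ∀ (a : Act d) (o : O),
      DifferentiableAt ℝ
        (fun ϑ => (u ϑ).toFun a (flowTime K (k + 1)) (flowTime K k) o) θ' ∧
      ‖(u θ').toFun a (flowTime K (k + 1)) (flowTime K k) o‖ ≤ C * (1 + ‖a‖) ^ m ∧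
      ‖fderiv ℝ (fun ϑ => (u ϑ).toFun a (flowTime K (k + 1)) (flowTime K k) o) θ'‖
        ≤ C * (1 + ‖a‖) ^ m) :
    (∀ᶠ θ' in nhds θ,
      ∫⁻ ω, M.absReturn ω ∂(M.rollout ((u θ').policy σ K)) < ⊤ ∧
      (∀ o, ∫⁻ ω, M.absReturn ω ∂(M.rolloutFromObs ((u θ').policy σ K) o) < ⊤) ∧
      (∀ o a, ∫⁻ ω, M.absReturn ω ∂(M.rolloutFromPair ((u θ').policy σ K) (o, a)) < ⊤)) ∧
    Integrable
      (fun x : O × (Fin (K + 1) → Act d) =>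
        M.advantage ((u θ).policy σ K) x.1 (x.2 (Fin.last K)) •
          gradient (fun ϑ => ∑ k : Fin K, Real.log
            ((u ϑ).transitionDensity σ K k x.1 (x.2 k.castSucc) (x.2 k.succ))) θ)
      (M.visitation ((u θ).policy σ K) ⊗ₘ (u θ).chain σ K K) ∧
    HasGradientAt (fun ϑ => M.J ((u ϑ).policy σ K))
      (∫ x : O × (Fin (K + 1) → Act d),
        M.advantage ((u θ).policy σ K) x.1 (x.2 (Fin.last K)) •
          gradient (fun ϑ => ∑ k : Fin K, Real.log
            ((u ϑ).transitionDensity σ K k x.1 (x.2 k.castSucc) (x.2 k.succ))) θ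
        ∂(M.visitation ((u θ).policy σ K) ⊗ₘ (u θ).chain σ K K)) θ := by
  obtain ⟨Cr, j, reward_le⟩ := hr
  obtain ⟨ε, hε, Cu, m, velocity_bounds⟩ := hu
  have le_toNNReal_mul (C : ℝ) (m : ℕ) (a : Act d) :
      C * (1 + ‖a‖) ^ m ≤ C.toNNReal * (1 + ‖a‖) ^ m :=
    mul_le_mul_of_nonneg_right C.le_coe_toNNReal (by positivity)
  have smooth (ϑ) (hϑ : ϑ ∈ Metric.ball θ ε) :
      VelocityField.SmoothPolynomialGrowthAt u K Cu.toNNReal m ϑ :=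
    ⟨fun k hk a o => (velocity_bounds ϑ hϑ k hk a o).2.1.trans (le_toNNReal_mul _ _ a),
      fun k hk a o => (velocity_bounds ϑ hϑ k hk a o).1,
      fun k hk a o => (velocity_bounds ϑ hϑ k hk a o).2.2.trans (le_toNNReal_mul _ _ a)⟩
  set c : ℝ≥0 := max 1 Cr.toNNReal
  have one_le_weight (a : Act d) : 1 ≤ c * (1 + ‖a‖₊) ^ j :=
    one_le_mul (le_max_left _ _) (one_le_pow₀ le_self_add)
  have reward_le_weight (o : O) (a : Act d) : ‖M.reward o a‖₊ ≤ c * (1 + ‖a‖₊) ^ j :=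
    ((reward_le o a).trans (le_toNNReal_mul _ _ a)).trans <|
      mul_le_mul_of_nonneg_right (le_max_right 1 Cr.toNNReal) (by positivity)
  obtain ⟨b, dominatedLogDensity⟩ :=
    VelocityField.exists_dominatedLogDensity_chain hσ hε smooth c j
  obtain ⟨dominatedBy, policyGradient⟩ := M.policyGradient (π := fun ϑ => (u ϑ).policy σ K)
    dominatedLogDensity (fun _ => rfl) (measurable_pi_apply _) (by fun_prop) one_le_weight
    reward_le_weight
  exact ⟨dominatedBy.mono fun _ h => h.lintegral_absReturn_rollouts_lt_top, policyGradient⟩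

theorem mainTheorem1 {d p K : ℕ} (hK : 0 < K) {σ : ℝ} (hσ : 0 < σ)
    {O : Type*} [MeasurableSpace O] (M : MDP O (Act d))
    (u : EuclideanSpace ℝ (Fin p) → VelocityField d O) (θ : EuclideanSpace ℝ (Fin p))
    -- the reward grows at most polynomially in the action
    (hr : ∃ (C : ℝ) (m : ℕ), ∀ (o : O) (a : Act d), |M.reward o a| ≤ C * (1 + ‖a‖) ^ m)
    -- near `θ` the network is differentiable in the parameters, and the network and its parameter
    -- derivative grow at most polynomially in the denoising state
    (hu : ∃ ε > 0, ∃ (C : ℝ) (m : ℕ), ∀ θ' ∈ Metric.ball θ ε, ∀ k < K, ∀ (a : Act d) (o : O),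
      DifferentiableAt ℝ
        (fun ϑ => (u ϑ).toFun a (flowTime K (k + 1)) (flowTime K k) o) θ' ∧
      ‖(u θ').toFun a (flowTime K (k + 1)) (flowTime K k) o‖ ≤ C * (1 + ‖a‖) ^ m ∧
      ‖fderiv ℝ (fun ϑ => (u ϑ).toFun a (flowTime K (k + 1)) (flowTime K k) o) θ'‖
        ≤ C * (1 + ‖a‖) ^ m) :
    -- near `θ` the returns that define `J`, `V` and `Q` converge absolutely in expectation
    (∀ᶠ θ' in nhds θ,
      ∫⁻ ω, M.absReturn ω ∂(M.rollout ((u θ').policy σ K)) < ⊤ ∧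
      (∀ o, ∫⁻ ω, M.absReturn ω ∂(M.rolloutFromObs ((u θ').policy σ K) o) < ⊤) ∧
      (∀ o a, ∫⁻ ω, M.absReturn ω ∂(M.rolloutFromPair ((u θ').policy σ K) (o, a)) < ⊤)) ∧
    -- the expectation in the policy gradient exists
    Integrable
      (fun x : O × (Fin (K + 1) → Act d) =>
        M.advantage ((u θ).policy σ K) x.1 (x.2 (Fin.last K)) •
          gradient (fun ϑ => ∑ k : Fin K, Real.log
            ((u ϑ).transitionDensity σ K k x.1 (x.2 k.castSucc) (x.2 k.succ))) θ)
      (M.visitation ((u θ).policy σ K) ⊗ₘ (u θ).chain σ K K) ∧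
    -- the policy gradient formula
    HasGradientAt (fun ϑ => M.J ((u ϑ).policy σ K))
      (∫ x : O × (Fin (K + 1) → Act d),
        M.advantage ((u θ).policy σ K) x.1 (x.2 (Fin.last K)) •
          gradient (fun ϑ => ∑ k : Fin K, Real.log
            ((u ϑ).transitionDensity σ K k x.1 (x.2 k.castSucc) (x.2 k.succ))) θ
        ∂(M.visitation ((u θ).policy σ K) ⊗ₘ (u θ).chain σ K K)) θ :=
  mainTheorem1_general hσ.ne' M u θ hr hu
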